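/- **Theorem.** For $k\ge 0$ let $P_k(x)=\frac{\sqrt{2k+1}}{k!}\frac{\mathrm d^k}{\mathrm dx^k}(x^2-x)^k$ be the normalized shifted Legendre polynomials on $[0,1]$, and let $\xi_1=\frac1{2\sqrt3}$. A continuous-stage Runge–Kutta–Nyström (csRKN) method with coefficients $(\bar A_{\tau,\sigma},\bar B_\tau,B_\tau,C_\tau)$, $\tau,\sigma\in[0,1]$, applied to $q''=f(t,q)$ with $f:\mathbb R\times\mathbb R^d\to\mathbb R^d$ smooth, maps $(q_0,q_0')$ at time $t_0$ to $(q_1,q_1')$ at time $t_0+h$ by $$Q_\tau=q_0+hC_\tau q_0'+h^2\int_0^1\bar A_{\tau,\sigma}f(t_0+C_\sigma h,Q_\sigma)\,\mathrm d\sigma\quad(\tau\in[0,1]),$$ $$q_1=q_0+hq_0'+h^2\int_0^1\bar B_\tau f(t_0+C_\tau h,Q_\tau)\,\mathrm d\tau,\qquad q_1'=q_0'+h\int_0^1B_\tau f(t_0+C_\tau h,Q_\tau)\,\mathrm d\tau .$$ The method is *symmetric* if it is left unaltered by exchanging $h\leftrightarrow-h$, $t_0\leftrightarrow t_0+h$ and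 $(q_0,q_0')\leftrightarrow(q_1,q_1')$, that is, if it equals its adjoint $\Phi_h^*=\Phi_{-h}^{-1}$. It is *of order at least $p$* if for every $d$, every smooth $f$ and all initial data $q(t_0)=q_0$, $q'(t_0)=q'_0$, the result $(q_1,q_1')$ is well defined for small $|h|$ (for each $r>0$, once $|h|$ is small enough, the stage equation has a solution with all $Q_\tau$ in the closed ball of radius $r$ about $q_0$, and all such solutions give the same result), and the exact solution $q$ satisfies $q(t_0+h)-q_1=\mathcal O(h^{p+1})$ and $q'(t_0+h)-q_1'=\mathcal O(h^{p+1})$ as $h\to0$. Suppose that $\bar B_\tau=B_\tau(1-C_\tau)$, $B_\tau=1$, $C_\tau=\tau$ for $\tau\in[0,1]$ and that, with real numbers $\alpha_{(i,j)}$, $$\bar A_{\tau,\sigma}=\alpha_{(0,0)}-\tfrac12\xi_1P_1(\sigma)+\tfrac12\xi_1P_1(\tau)+\sum_{\substack{i+j\text{ even}\\ i+j>1}}\alpha_{(i,j)}P_i(\tau)P_j(\sigma),\qquad \tau,\sigma\in[0,1],$$ where the sum over $i,j\ge 0$ is finite or converges unconditionally at every point of $[0,1]^2$. Then: 1. the csRKN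 method is symmetric and of order at least $2$; 2. if $\alpha_{(0,0)}=\frac16$, then it is of order at least $4$; 3. if $\alpha_{(0,0)}=\frac16$, $\alpha_{(1,1)}=-\frac1{10}$, $\alpha_{(2,0)}=\alpha_{(0,2)}=\frac{\sqrt5}{60}$, and $\alpha_{(i,0)}=0$ for all even $i>2$, then it is of order at least $6$. -/

import Mathlib

open Set Filter Topology MeasureTheory
open scoped ContDiff

noncomputable section

/-- The space `ℝ^d` with its Euclidean norm. -/
abbrev Vec (d : ℕ) : Type := EuclideanSpace ℝ (Fin d)

/-- The normalized shifted Legendre polynomial of degree `k`, by Rodrigues' formula: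
`P_k(x) = √(2k+1) / k! * (d/dx)^k (x^2 - x)^k`. -/
def legendreP (k : ℕ) (x : ℝ) : ℝ :=
  Real.sqrt (2 * (k : ℝ) + 1) / (Nat.factorial k : ℝ) *
    (Polynomial.derivative^[k] ((Polynomial.X ^ 2 - Polynomial.X) ^ k : Polynomial ℝ)).eval x

/-- The constants `ξ_ι = 1 / (2 √(4 ι² - 1))`, used for `ι ≥ 1`. -/
def legendreXi (ι : ℕ) : ℝ := 1 / (2 * Real.sqrt (4 * (ι : ℝ) ^ 2 - 1))

/-- The coefficients `(Ā, B̄, B, C)` of a continuous-stage Runge-Kutta-Nyström method. Only their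
values for arguments in `[0,1]` matter. -/
structure CSRKN where
  A : ℝ → ℝ → ℝ
  Bbar : ℝ → ℝ
  B : ℝ → ℝ
  C : ℝ → ℝ

/-- A (possibly implicit) one-step method for second-order equations in `ℝ^d`, as a relation:
`Φ h t₀ z₀ z₁` says that one step of size `h` from `z₀ = (q₀, q₀')` at time `t₀` leads to
`z₁ = (q₁, q₁')` at time `t₀ + h`. -/
abbrev OneStepMethod (d : ℕ) : Type := ℝ → ℝ → Vec d × Vec d → Vec d × Vec d → Prop

/-- The adjoint method `Φ*_h = (Φ_{-h})⁻¹`: exchange `h ↔ -h`, `z₀ ↔ z₁`, `t₀ ↔ t₁ = t₀ + h`. -/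
def OneStepMethod.adjoint {d : ℕ} (Φ : OneStepMethod d) : OneStepMethod d :=
  fun h t₀ z₀ z₁ => Φ (-h) (t₀ + h) z₁ z₀

/-- `Q` is a family of stages, and `z₁` the result, of one step of size `h` of the method with
coefficients `M`, applied to `q'' = f(t, q)` from `z₀ = (q₀, q₀')` at time `t₀`. All the integrals
that occur are required to exist. -/
structure CSRKN.IsStep (M : CSRKN) {d : ℕ} (f : ℝ → Vec d → Vec d) (h t₀ : ℝ)
    (z₀ : Vec d × Vec d) (Q : ℝ → Vec d) (z₁ : Vec d × Vec d) : Prop where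
  integrable_stage : ∀ τ ∈ Icc (0 : ℝ) 1,
    IntervalIntegrable (fun σ => M.A τ σ • f (t₀ + M.C σ * h) (Q σ)) volume 0 1
  integrable_position :
    IntervalIntegrable (fun τ => M.Bbar τ • f (t₀ + M.C τ * h) (Q τ)) volume 0 1
  integrable_velocity :
    IntervalIntegrable (fun τ => M.B τ • f (t₀ + M.C τ * h) (Q τ)) volume 0 1
  stage : ∀ τ ∈ Icc (0 : ℝ) 1, Q τ = z₀.1 + (h * M.C τ) • z₀.2
    + h ^ 2 • ∫ σ in (0 : ℝ)..1, M.A τ σ • f (t₀ + M.C σ * h) (Q σ)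
  position : z₁.1 = z₀.1 + h • z₀.2
    + h ^ 2 • ∫ τ in (0 : ℝ)..1, M.Bbar τ • f (t₀ + M.C τ * h) (Q τ)
  velocity : z₁.2 = z₀.2 + h • ∫ τ in (0 : ℝ)..1, M.B τ • f (t₀ + M.C τ * h) (Q τ)

/-- The one-step method with coefficients `M` applied to `q'' = f(t, q)`, where solutions of the
implicit stage equation are sought in the region `U` (the stage equation is nonlinear and may have
several solutions; `U = univ` admits all of them, while a bounded neighbourhood of `q₀` singles out
the solution close to `q₀` when `h` is small). -/
def CSRKN.method (M : CSRKN) {d : ℕ} (f : ℝ → Vec d → Vec d) (U : Set (Vec d)) :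
    OneStepMethod d :=
  fun h t₀ z₀ z₁ => ∃ Q : ℝ → Vec d, (∀ τ ∈ Icc (0 : ℝ) 1, Q τ ∈ U) ∧ M.IsStep f h t₀ z₀ Q z₁

/-- The method is symmetric: it equals its adjoint, for every smooth right-hand side (and every
region in which the stages are sought). -/
def CSRKN.IsSymmetric (M : CSRKN) : Prop :=
  ∀ (d : ℕ) (f : ℝ → Vec d → Vec d), ContDiff ℝ ∞ (Function.uncurry f) →
    ∀ U : Set (Vec d), (M.method f U).adjoint = M.method f U

/-- The pair `(q, v)` is, near `t₀`, a solution `q` of `q'' = f(t, q)`, `q(t₀) = q₀`,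
`q'(t₀) = v₀`, together with its derivative `v = q'`. -/
structure IsLocalSolution {d : ℕ} (f : ℝ → Vec d → Vec d) (t₀ : ℝ) (q₀ v₀ : Vec d)
    (q v : ℝ → Vec d) : Prop where
  hasDerivAt : ∀ᶠ t in 𝓝 t₀, HasDerivAt q (v t) t ∧ HasDerivAt v (f t (q t)) t
  init_position : q t₀ = q₀
  init_velocity : v t₀ = v₀

/-- The method has order at least `p`: for every smooth problem, as `h → 0`, the numerical result
`(q₁, q₁')` is well defined (in any prescribed ball about `q₀` the stage equation can be solved,
with a unique result), and `q(t₀+h) - q₁ = O(h^{p+1})`, `q'(t₀+h) - q₁' = O(h^{p+1})`. -/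
def CSRKN.HasOrderAtLeast (M : CSRKN) (p : ℕ) : Prop :=
  ∀ (d : ℕ) (f : ℝ → Vec d → Vec d), ContDiff ℝ ∞ (Function.uncurry f) →
    ∀ (t₀ : ℝ) (q₀ v₀ : Vec d) (q v : ℝ → Vec d), IsLocalSolution f t₀ q₀ v₀ q v →
    ∀ r : ℝ, 0 < r → ∃ K h₀ : ℝ, 0 < h₀ ∧ ∀ h : ℝ, |h| ≤ h₀ →
      ∃ z₁ : Vec d × Vec d,
        M.method f (Metric.closedBall q₀ r) h t₀ (q₀, v₀) z₁ ∧
        (∀ z, M.method f (Metric.closedBall q₀ r) h t₀ (q₀, v₀) z → z = z₁) ∧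
        ‖q (t₀ + h) - z₁.1‖ ≤ K * |h| ^ (p + 1) ∧
        ‖v (t₀ + h) - z₁.2‖ ≤ K * |h| ^ (p + 1)

/-- The kernel has the form
`A(τ,σ) = α₀₀ - ½ ξ₁ P₁(σ) + ½ ξ₁ P₁(τ) + ∑ α_{ij} P_i(τ) P_j(σ)` for `τ, σ ∈ [0,1]`, where the
sum, finite or infinite, extends over all `i, j` with `i + j` even and `i + j > 1`. -/
def HasSymmetricLegendreForm (A : ℝ → ℝ → ℝ) (α : ℕ → ℕ → ℝ) : Prop :=
  ∀ τ ∈ Icc (0 : ℝ) 1, ∀ σ ∈ Icc (0 : ℝ) 1, ∃ S : ℝ,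
    HasSum (fun ij : ℕ × ℕ =>
      if Even (ij.1 + ij.2) ∧ 1 < ij.1 + ij.2 then
        α ij.1 ij.2 * legendreP ij.1 τ * legendreP ij.2 σ
      else 0) S ∧
    A τ σ = α 0 0 - 1 / 2 * legendreXi 1 * legendreP 1 σ
      + 1 / 2 * legendreXi 1 * legendreP 1 τ + S

end

/-!
The coefficient `A` is first replaced by a continuous function. A convergent family of reals is
absolutely convergent, and every `|P_k|` is largest at the end points of `[0, 1]`
(`abs_legendreP_le`, from Legendre's differential equation), so convergence of the expansion at the
corner `(1, 1)` alone makes it normally convergent on the square. The parity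
`P_k(1 - x) = (-1)^k P_k(x)` and the shape of the linear terms give
`A(1 - τ, 1 - σ) = A(τ, σ) - τ + σ` (`IsSymmetricKernel`), and this makes the reversed stages
`Q(1 - τ)` of an adjoint step the stages of a step of the method (`kernelMethod_isStep_reverse`).

For the order, no trees or order conditions are used. The exact solution satisfies the stage
equation with the kernel `(τ - σ)₊`, so with `D(τ, σ) = (τ - σ)₊ - A(τ, σ)` the error `E` of the
stages and the resulting error `Δ = J E + O(E²)` of the values of `f` satisfy
`E(τ) = h² ∫ D(τ, σ) g(hσ) dσ + h² ∫ A(τ, σ) Δ(σ) dσ`, where `g` and `J` are smooth (`q''` and the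
derivative of `f` along the exact solution). The error of the result is `h² ∫ (1 - τ) Δ` in the
position and `h ∫ Δ` in the velocity. Taylor expansion of `g` and `J` reduces the leading part
`h² ∫∫ u(τ) J(hτ) D(τ, σ) g(hσ)` to moments `∫∫ τ^a D(τ, σ) σ^b`.

* `E = O(h²)` always, which gives order `2`.
* If `α₀₀ = 1/6` then `∫∫ D = 0`. Since `(τ - σ)₊` has the same symmetry as `A`, the defect `D` is
  invariant under `(τ, σ) ↦ (1 - τ, 1 - σ)`, so the moments with `a + b = 1` vanish too
  (`defectMomentsVanish_two`); this gives order `4`.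
* Under the last set of conditions, the row integrals of `D` vanish, whence `E = O(h³)` and
  `Δ = J E + O(h⁶)`, and by symmetry so do all moments with `a + b < 4`
  (`defectMomentsVanish_four`). The remaining term of the velocity error has leading coefficient
  `∫ w(τ) ∫ D(τ, σ) σ dσ dτ` with the column integrals `w` of `A`; it vanishes since the inner
  integral is odd about `1/2` and orthogonal to `τ`, while the odd part of `w` is a multiple of
  `τ - 1/2` (`integral_column_mul_defectMoment_one`, `StageError.isUniformO_integral_Δ_six`).

That the step is well defined for small `h` is the contraction principle
(`eventually_stage_exists`, `eventually_stage_unique`).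
-/

/-! ### Shifted Legendre polynomials -/

open Polynomial in
/-- The polynomial `(d/dx)^k (x² - x)^k` of Rodrigues' formula. -/
noncomputable def rodrigues (k : ℕ) : Polynomial ℝ :=
  derivative^[k] ((X ^ 2 - X) ^ k)

lemma legendreP_eq_rodrigues (k : ℕ) (x : ℝ) :
    legendreP k x =
      Real.sqrt (2 * (k : ℝ) + 1) / (Nat.factorial k : ℝ) * (rodrigues k).eval x := rfl

lemma continuous_legendreP (k : ℕ) : Continuous (legendreP k) := by
  unfold legendreP
  fun_prop

lemma rodrigues_eval_one_sub (k : ℕ) (x : ℝ) :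
    (rodrigues k).eval (1 - x) = (-1) ^ k * (rodrigues k).eval x := by
  have h := Polynomial.iterate_derivative_comp_one_sub_X
    ((Polynomial.X ^ 2 - Polynomial.X : Polynomial ℝ) ^ k) k
  have h2 : ((Polynomial.X ^ 2 - Polynomial.X : Polynomial ℝ) ^ k).comp (1 - Polynomial.X)
      = (Polynomial.X ^ 2 - Polynomial.X) ^ k := by
    rw [Polynomial.pow_comp, Polynomial.sub_comp, Polynomial.pow_comp, Polynomial.X_comp,
      show (1 - Polynomial.X : Polynomial ℝ) ^ 2 - (1 - Polynomial.X)
        = Polynomial.X ^ 2 - Polynomial.X by ring]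
  rw [h2] at h
  have h3 := congrArg (Polynomial.eval x) h
  simp only [Polynomial.eval_mul, Polynomial.eval_pow, Polynomial.eval_neg, Polynomial.eval_one,
    Polynomial.eval_comp, Polynomial.eval_sub, Polynomial.eval_X] at h3
  have h4 : (rodrigues k).eval x = (-1) ^ k * (rodrigues k).eval (1 - x) := h3
  rw [h4, ← mul_assoc, ← mul_pow]
  norm_num

lemma legendreP_one_sub (k : ℕ) (x : ℝ) : legendreP k (1 - x) = (-1) ^ k * legendreP k x := by
  rw [legendreP_eq_rodrigues, legendreP_eq_rodrigues, rodrigues_eval_one_sub]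
  ring

open Polynomial in
/-- The differential equation `(x² - x) y' = k (2x - 1) y` of `y = (x² - x)^k`, differentiated
`n + 1` times. -/
lemma iterate_derivative_rodrigues_ode (k n : ℕ) :
    (X ^ 2 - X : ℝ[X]) * derivative^[n + 2] ((X ^ 2 - X) ^ k)
      + ((n : ℝ[X]) + 1 - (k : ℝ[X])) * (2 * X - 1) * derivative^[n + 1] ((X ^ 2 - X) ^ k)
      + ((n : ℝ[X]) * ((n : ℝ[X]) + 1) - 2 * (k : ℝ[X]) * ((n : ℝ[X]) + 1))
        * derivative^[n] ((X ^ 2 - X) ^ k) = 0 := by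
  have hC : (C 2 : ℝ[X]) = 2 := map_ofNat C 2
  induction n with
  | zero =>
    have h : (X ^ 2 - X : ℝ[X]) * derivative ((X ^ 2 - X) ^ k)
        - (k : ℝ[X]) * (2 * X - 1) * (X ^ 2 - X) ^ k = 0 := by
      rcases k with _ | k
      · simp
      · rw [derivative_pow_succ]
        simp only [derivative_sub, derivative_X_pow, derivative_X]
        push_cast
        simp [hC]
        ring
    have h' := congrArg derivative h
    simp only [derivative_sub, derivative_mul, derivative_X_pow, derivative_X,
      derivative_natCast, derivative_one, derivative_ofNat, derivative_zero] at h'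
    simp only [Function.iterate_succ, Function.iterate_zero, Function.comp, id]
    push_cast at h' ⊢
    simp [hC] at h'
    linear_combination h'
  | succ n ih =>
    have h' := congrArg derivative ih
    simp only [derivative_sub, derivative_add, derivative_mul, derivative_X_pow, derivative_X,
      derivative_natCast, derivative_one, derivative_ofNat, derivative_zero,
      ← Function.iterate_succ_apply' derivative] at h'
    push_cast at h' ⊢
    simp [hC] at h'
    simp only [Function.iterate_succ, Function.comp] at h' ⊢
    linear_combination h'

open Polynomial in
/-- Legendre's differential equation. -/
lemma rodrigues_ode (k : ℕ) (x : ℝ) :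
    (x ^ 2 - x) * (derivative (derivative (rodrigues k))).eval x
      + (2 * x - 1) * (derivative (rodrigues k)).eval x
      = k * (k + 1) * (rodrigues k).eval x := by
  have h := congrArg (eval x) (iterate_derivative_rodrigues_ode k k)
  simp only [Function.iterate_succ_apply', ← rodrigues.eq_1] at h
  simp at h
  linear_combination h

/-- On `[0, 1]`, a shifted Legendre polynomial is largest at the right end point. By Legendre's
equation, `y = rodrigues k` satisfies
`(k (k + 1) y² + (x - x²) y'²)' = (2x - 1) y'²`, which gives the bound on `[1/2, 1]`; the other half
follows by reflection. -/
lemma abs_rodrigues_eval_le (k : ℕ) {x : ℝ} (hx : x ∈ Icc (0 : ℝ) 1) :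
    |(rodrigues k).eval x| ≤ |(rodrigues k).eval 1| := by
  wlog hx2 : 1 / 2 ≤ x generalizing x
  · have := this (x := 1 - x) ⟨by linarith [hx.2], by linarith [hx.1]⟩ (by linarith)
    rw [rodrigues_eval_one_sub, abs_mul, abs_pow, abs_neg, abs_one, one_pow, one_mul] at this
    exact this
  rcases Nat.eq_zero_or_pos k with rfl | hk
  · simp [rodrigues]
  set y := rodrigues k
  set g : ℝ → ℝ := fun x => k * (k + 1) * (y.eval x) ^ 2
    + (x - x ^ 2) * (y.derivative.eval x) ^ 2 with hg
  have hd : ∀ x, HasDerivAt g ((2 * x - 1) * (y.derivative.eval x) ^ 2) x := by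
    intro x
    have h1 := (((y.hasDerivAt x).pow 2).const_mul ((k : ℝ) * (k + 1))).add
      ((((hasDerivAt_id x).sub ((hasDerivAt_id x).pow 2))).mul
        ((y.derivative.hasDerivAt x).pow 2))
    refine (h1.congr_deriv ?_)
    have := rodrigues_ode k x
    simp only [Pi.pow_apply, Pi.sub_apply, id] at *
    push_cast
    linear_combination (2 * y.derivative.eval x) * (-this)
  have hmono : MonotoneOn g (Icc (1 / 2) 1) := by
    refine monotoneOn_of_deriv_nonneg (convex_Icc _ _)
      (fun x _ => (hd x).continuousAt.continuousWithinAt)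
      (fun x _ => (hd x).differentiableAt.differentiableWithinAt) (fun x hx => ?_)
    rw [interior_Icc] at hx
    rw [(hd x).deriv]
    have : 0 ≤ 2 * x - 1 := by linarith [hx.1]
    positivity
  have h := hmono ⟨hx2, hx.2⟩ (right_mem_Icc.2 (by norm_num)) hx.2
  have h0 : 0 ≤ (x - x ^ 2) * (y.derivative.eval x) ^ 2 :=
    mul_nonneg (by nlinarith [hx.1, hx.2]) (sq_nonneg _)
  simp only [hg] at h
  have hk' : (0 : ℝ) < k * (k + 1) := by positivity
  refine sq_le_sq.1 ?_
  refine le_of_mul_le_mul_left ?_ hk'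
  linarith

lemma abs_legendreP_le (k : ℕ) {x : ℝ} (hx : x ∈ Icc (0 : ℝ) 1) :
    |legendreP k x| ≤ |legendreP k 1| := by
  rw [legendreP_eq_rodrigues, legendreP_eq_rodrigues, abs_mul, abs_mul]
  exact mul_le_mul_of_nonneg_left (abs_rodrigues_eval_le k hx) (abs_nonneg _)

open Polynomial in
/-- Repeated integration by parts: the `k`-th derivative of a polynomial whose derivatives of order
less than `k` vanish at both end points is orthogonal to `x^b` for `b < k`. -/
lemma integral_iterate_derivative_mul_pow_eq_zero (p : ℝ[X]) (b : ℕ) : ∀ k : ℕ, b < k →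
    (∀ i < k, (derivative^[i] p).eval 0 = 0 ∧ (derivative^[i] p).eval 1 = 0) →
    ∫ x in (0 : ℝ)..1, (derivative^[k] p).eval x * x ^ b = 0 := by
  induction b with
  | zero =>
    intro k hk h
    obtain ⟨k, rfl⟩ : ∃ m, k = m + 1 := ⟨k - 1, by omega⟩
    simp only [pow_zero, mul_one, Function.iterate_succ_apply']
    rw [intervalIntegral.integral_eq_sub_of_hasDerivAt
      (fun x _ => (derivative^[k] p).hasDerivAt x)
      ((Polynomial.continuous _).intervalIntegrable _ _)]
    rw [(h k (by omega)).1, (h k (by omega)).2, sub_zero]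
  | succ b ih =>
    intro k hk h
    obtain ⟨k, rfl⟩ : ∃ m, k = m + 1 := ⟨k - 1, by omega⟩
    simp only [Function.iterate_succ_apply']
    have hp : ∀ x ∈ uIcc (0 : ℝ) 1, HasDerivAt (fun x : ℝ => x ^ (b + 1))
        (((b : ℝ) + 1) * x ^ b) x := by
      intro x _
      simpa using hasDerivAt_pow (b + 1) x
    simp only [mul_comm _ (_ ^ (b + 1))]
    rw [intervalIntegral.integral_mul_deriv_eq_deriv_mul hp
      (fun x _ => (derivative^[k] p).hasDerivAt x)
      (Continuous.intervalIntegrable (by fun_prop) _ _)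
      ((Polynomial.continuous _).intervalIntegrable _ _)]
    have := ih k (by omega) (fun i hi => h i (by omega))
    rw [(h k (by omega)).1, (h k (by omega)).2]
    simp only [mul_assoc, mul_comm (_ ^ b)]
    rw [intervalIntegral.integral_const_mul, this]
    simp

open Polynomial in
lemma integral_legendreP_mul_pow_eq_zero {b k : ℕ} (h : b < k) :
    ∫ x in (0 : ℝ)..1, legendreP k x * x ^ b = 0 := by
  have h1 : ∫ x in (0 : ℝ)..1, (rodrigues k).eval x * x ^ b = 0 := by
    refine integral_iterate_derivative_mul_pow_eq_zero _ b k h fun i hi => ?_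
    obtain ⟨q, hq⟩ := pow_sub_dvd_iterate_derivative_pow (X ^ 2 - X : ℝ[X]) k i
    rw [hq]
    have : k - i ≠ 0 := by omega
    simp [this]
  simp only [legendreP_eq_rodrigues, mul_assoc]
  rw [intervalIntegral.integral_const_mul, h1, mul_zero]

lemma legendreP_zero (x : ℝ) : legendreP 0 x = 1 := by
  simp [legendreP]

lemma legendreP_one (x : ℝ) : legendreP 1 x = Real.sqrt 3 * (2 * x - 1) := by
  simp [legendreP]
  norm_num

lemma legendreP_two (x : ℝ) : legendreP 2 x = Real.sqrt 5 * (6 * x ^ 2 - 6 * x + 1) := by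
  have : (Polynomial.X ^ 2 - Polynomial.X : Polynomial ℝ) ^ 2
      = Polynomial.X ^ 4 - 2 * Polynomial.X ^ 3 + Polynomial.X ^ 2 := by ring
  simp only [legendreP, this]
  simp
  norm_num
  ring

lemma half_legendreXi_one_mul_legendreP_one (x : ℝ) :
    1 / 2 * legendreXi 1 * legendreP 1 x = (2 * x - 1) / 4 := by
  rw [legendreP_one, legendreXi]
  have h3 : Real.sqrt 3 ≠ 0 := by positivity
  norm_num
  field_simp
  ring

/-! ### The kernel as a continuous function and its moments -/

/-- The term of index `ij` of the Legendre expansion. -/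
noncomputable def legendreTerm (α : ℕ → ℕ → ℝ) (ij : ℕ × ℕ) (τ σ : ℝ) : ℝ :=
  if Even (ij.1 + ij.2) ∧ 1 < ij.1 + ij.2 then
    α ij.1 ij.2 * legendreP ij.1 τ * legendreP ij.2 σ
  else 0

/-- The sum of the Legendre expansion on the unit square, extended continuously to the plane by
composition with the projection of each coordinate to `[0, 1]`. -/
noncomputable def legendreSum (α : ℕ → ℕ → ℝ) (τ σ : ℝ) : ℝ :=
  ∑' ij, legendreTerm α ij (projIcc (0 : ℝ) 1 zero_le_one τ) (projIcc (0 : ℝ) 1 zero_le_one σ)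

/-- A continuous function on the plane that agrees with the coefficient `A` of the method on the
unit square. -/
noncomputable def legendreKernel (α : ℕ → ℕ → ℝ) (τ σ : ℝ) : ℝ :=
  α 0 0 - (2 * σ - 1) / 4 + (2 * τ - 1) / 4 + legendreSum α τ σ

lemma continuous_legendreTerm (α : ℕ → ℕ → ℝ) (ij : ℕ × ℕ) :
    Continuous (Function.uncurry (legendreTerm α ij)) := by
  have := continuous_legendreP ij.1
  have := continuous_legendreP ij.2
  unfold legendreTerm
  split_ifs
  · simp only [Function.uncurry_def]
    fun_prop
  · exact continuous_const

lemma abs_legendreTerm_le (α : ℕ → ℕ → ℝ) (ij : ℕ × ℕ) {τ σ : ℝ} (hτ : τ ∈ Icc (0 : ℝ) 1)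
    (hσ : σ ∈ Icc (0 : ℝ) 1) : |legendreTerm α ij τ σ| ≤ |legendreTerm α ij 1 1| := by
  unfold legendreTerm
  split_ifs
  · simp only [abs_mul]
    exact mul_le_mul (mul_le_mul_of_nonneg_left (abs_legendreP_le _ hτ) (abs_nonneg _))
      (abs_legendreP_le _ hσ) (abs_nonneg _) (by positivity)
  · rfl

lemma legendreTerm_one_sub (α : ℕ → ℕ → ℝ) (ij : ℕ × ℕ) (τ σ : ℝ) :
    legendreTerm α ij (1 - τ) (1 - σ) = legendreTerm α ij τ σ := by
  unfold legendreTerm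
  split_ifs with h
  · rw [legendreP_one_sub, legendreP_one_sub]
    have : ((-1 : ℝ)) ^ ij.1 * (-1) ^ ij.2 = 1 := by rw [← pow_add]; exact h.1.neg_one_pow
    linear_combination (α ij.1 ij.2 * legendreP ij.1 τ * legendreP ij.2 σ) * this
  · rfl

lemma legendreSum_of_mem (α : ℕ → ℕ → ℝ) {τ σ : ℝ} (hτ : τ ∈ Icc (0 : ℝ) 1)
    (hσ : σ ∈ Icc (0 : ℝ) 1) : legendreSum α τ σ = ∑' ij, legendreTerm α ij τ σ := by
  simp only [legendreSum, projIcc_of_mem _ hτ, projIcc_of_mem _ hσ]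

lemma one_sub_mem_unitInterval {x : ℝ} (hx : x ∈ Icc (0 : ℝ) 1) : 1 - x ∈ Icc (0 : ℝ) 1 :=
  ⟨by linarith [hx.2], by linarith [hx.1]⟩

section Kernel

variable {A : ℝ → ℝ → ℝ} {α : ℕ → ℕ → ℝ}

/-- Pointwise convergence at the corner `(1, 1)`, where every `|P_k|` is largest, makes the
expansion normally convergent. -/
lemma HasSymmetricLegendreForm.summable (hA : HasSymmetricLegendreForm A α) :
    Summable fun ij => |legendreTerm α ij 1 1| := by
  obtain ⟨S, hS, -⟩ := hA 1 (right_mem_Icc.2 zero_le_one) 1 (right_mem_Icc.2 zero_le_one)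
  exact hS.summable.abs

lemma HasSymmetricLegendreForm.eq_legendreKernel (hA : HasSymmetricLegendreForm A α)
    {τ σ : ℝ} (hτ : τ ∈ Icc (0 : ℝ) 1) (hσ : σ ∈ Icc (0 : ℝ) 1) :
    A τ σ = legendreKernel α τ σ := by
  obtain ⟨S, hS, hAS⟩ := hA τ hτ σ hσ
  rw [hAS, legendreKernel, legendreSum_of_mem α hτ hσ, half_legendreXi_one_mul_legendreP_one,
    half_legendreXi_one_mul_legendreP_one]
  congr 1
  exact hS.tsum_eq.symm

lemma continuous_legendreSum (hs : Summable fun ij => |legendreTerm α ij 1 1|) :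
    Continuous (Function.uncurry (legendreSum α)) := by
  have hp : Continuous fun x : ℝ => (projIcc (0 : ℝ) 1 zero_le_one x : ℝ) :=
    continuous_subtype_val.comp continuous_projIcc
  refine continuous_tsum (fun ij => ?_) hs (fun ij p => ?_)
  · exact (continuous_legendreTerm α ij).comp
      ((hp.comp continuous_fst).prodMk (hp.comp continuous_snd))
  · exact abs_legendreTerm_le α ij (Subtype.mem _) (Subtype.mem _)

lemma continuous_legendreKernel (hs : Summable fun ij => |legendreTerm α ij 1 1|) :
    Continuous (Function.uncurry (legendreKernel α)) := by
  have := continuous_legendreSum hs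
  simp only [Function.uncurry_def, legendreKernel] at *
  fun_prop

lemma legendreKernel_one_sub {τ σ : ℝ} (hτ : τ ∈ Icc (0 : ℝ) 1) (hσ : σ ∈ Icc (0 : ℝ) 1) :
    legendreKernel α (1 - τ) (1 - σ) = legendreKernel α τ σ - τ + σ := by
  rw [legendreKernel, legendreKernel, legendreSum_of_mem α hτ hσ,
    legendreSum_of_mem α (one_sub_mem_unitInterval hτ) (one_sub_mem_unitInterval hσ)]
  simp only [legendreTerm_one_sub]
  ring

lemma hasSum_integral_legendreTerm (hs : Summable fun ij => |legendreTerm α ij 1 1|) (b : ℕ)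
    {τ : ℝ} (hτ : τ ∈ Icc (0 : ℝ) 1) :
    HasSum (fun ij => ∫ σ in (0 : ℝ)..1, legendreTerm α ij τ σ * σ ^ b)
      (∫ σ in (0 : ℝ)..1, legendreSum α τ σ * σ ^ b) := by
  have hI : ∀ {t : ℝ}, t ∈ uIoc (0 : ℝ) 1 → t ∈ Icc (0 : ℝ) 1 := fun h => by
    rw [uIoc_of_le zero_le_one] at h; exact Ioc_subset_Icc_self h
  refine intervalIntegral.hasSum_integral_of_dominated_convergence
    (fun ij _ => |legendreTerm α ij 1 1|) (fun ij => ?_) (fun ij => .of_forall fun t ht => ?_)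
    (.of_forall fun t _ => hs) intervalIntegrable_const (.of_forall fun t ht => ?_)
  · have h1 : Continuous fun σ => legendreTerm α ij τ σ :=
      (continuous_legendreTerm α ij).comp (by fun_prop : Continuous fun σ : ℝ => (τ, σ))
    exact (h1.mul (continuous_pow b)).aestronglyMeasurable
  · rw [Real.norm_eq_abs, abs_mul]
    refine (mul_le_of_le_one_right (abs_nonneg _) ?_).trans (abs_legendreTerm_le α ij hτ (hI ht))
    rw [abs_pow, abs_of_nonneg (hI ht).1]
    exact pow_le_one₀ (hI ht).1 (hI ht).2
  · refine HasSum.mul_right _ ?_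
    rw [legendreSum_of_mem α hτ (hI ht)]
    exact (Summable.of_norm_bounded hs
      fun ij => abs_legendreTerm_le α ij hτ (hI ht)).hasSum

lemma hasSum_integral_integral_legendreTerm (hs : Summable fun ij => |legendreTerm α ij 1 1|)
    (a b : ℕ) :
    HasSum (fun ij => ∫ τ in (0 : ℝ)..1, τ ^ a * ∫ σ in (0 : ℝ)..1, legendreTerm α ij τ σ * σ ^ b)
      (∫ τ in (0 : ℝ)..1, τ ^ a * ∫ σ in (0 : ℝ)..1, legendreSum α τ σ * σ ^ b) := by
  have hI : ∀ {t : ℝ}, t ∈ uIoc (0 : ℝ) 1 → t ∈ Icc (0 : ℝ) 1 := fun h => by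
    rw [uIoc_of_le zero_le_one] at h; exact Ioc_subset_Icc_self h
  refine intervalIntegral.hasSum_integral_of_dominated_convergence
    (fun ij _ => |legendreTerm α ij 1 1|) (fun ij => ?_) (fun ij => .of_forall fun t ht => ?_)
    (.of_forall fun t _ => hs) intervalIntegrable_const (.of_forall fun t ht => ?_)
  · have h1 : Continuous (Function.uncurry fun τ σ => legendreTerm α ij τ σ * σ ^ b) :=
      (continuous_legendreTerm α ij).mul (continuous_snd.pow b)
    exact ((continuous_pow a).mul
      (intervalIntegral.continuous_parametric_intervalIntegral_of_continuous'
        h1 0 1)).aestronglyMeasurable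
  · have h1 : ‖∫ σ in (0 : ℝ)..1, legendreTerm α ij t σ * σ ^ b‖
        ≤ |legendreTerm α ij 1 1| * |1 - 0| := by
      refine intervalIntegral.norm_integral_le_of_norm_le_const fun σ hσ => ?_
      rw [Real.norm_eq_abs, abs_mul]
      refine (mul_le_of_le_one_right (abs_nonneg _) ?_).trans
        (abs_legendreTerm_le α ij (hI ht) (hI hσ))
      rw [abs_pow, abs_of_nonneg (hI hσ).1]
      exact pow_le_one₀ (hI hσ).1 (hI hσ).2
    rw [norm_mul]
    refine (mul_le_of_le_one_left (norm_nonneg _) ?_).trans (by simpa using h1)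
    rw [norm_pow, Real.norm_eq_abs, abs_of_nonneg (hI ht).1]
    exact pow_le_one₀ (hI ht).1 (hI ht).2
  · exact (hasSum_integral_legendreTerm hs b (hI ht)).mul_left _

lemma integral_legendreTerm_mul_pow (ij : ℕ × ℕ) (b : ℕ) (τ : ℝ) :
    ∫ σ in (0 : ℝ)..1, legendreTerm α ij τ σ * σ ^ b =
      if Even (ij.1 + ij.2) ∧ 1 < ij.1 + ij.2 then
        α ij.1 ij.2 * legendreP ij.1 τ * ∫ σ in (0 : ℝ)..1, legendreP ij.2 σ * σ ^ b
      else 0 := by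
  unfold legendreTerm
  split_ifs
  · rw [← intervalIntegral.integral_const_mul]
    simp only [mul_assoc]
  · simp

lemma integral_integral_legendreTerm (ij : ℕ × ℕ) (a b : ℕ) :
    ∫ τ in (0 : ℝ)..1, τ ^ a * ∫ σ in (0 : ℝ)..1, legendreTerm α ij τ σ * σ ^ b =
      if Even (ij.1 + ij.2) ∧ 1 < ij.1 + ij.2 then
        α ij.1 ij.2 * (∫ τ in (0 : ℝ)..1, legendreP ij.1 τ * τ ^ a)
          * ∫ σ in (0 : ℝ)..1, legendreP ij.2 σ * σ ^ b
      else 0 := by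
  simp only [integral_legendreTerm_mul_pow]
  split_ifs
  · generalize ∫ σ in (0 : ℝ)..1, legendreP ij.2 σ * σ ^ b = c
    rw [← intervalIntegral.integral_const_mul, ← intervalIntegral.integral_mul_const]
    refine intervalIntegral.integral_congr fun τ _ => ?_
    ring
  · simp

lemma eq_of_hasSum_of_forall_ne {β : Type*} {F : β → ℝ} {s : ℝ} (h : HasSum F s) (i : β)
    (h0 : ∀ j, j ≠ i → F j = 0) : s = F i :=
  h.unique (hasSum_single i h0)

/-- Moments of the expansion: by orthogonality, of the terms with `i + j > 1` at most the one of
index `(a, b)` survives. -/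
lemma integral_integral_legendreSum (hs : Summable fun ij => |legendreTerm α ij 1 1|) (a b : ℕ)
    (hab : a + b ≤ 2) :
    ∫ τ in (0 : ℝ)..1, τ ^ a * ∫ σ in (0 : ℝ)..1, legendreSum α τ σ * σ ^ b =
      if a + b = 2 then α a b * (∫ τ in (0 : ℝ)..1, legendreP a τ * τ ^ a)
          * ∫ σ in (0 : ℝ)..1, legendreP b σ * σ ^ b
      else 0 := by
  have h := eq_of_hasSum_of_forall_ne (hasSum_integral_integral_legendreTerm hs a b) (a, b) ?_
  · rw [h, integral_integral_legendreTerm]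
    refine if_congr ⟨fun h => by simp only at h; omega, fun h => ?_⟩ rfl rfl
    simp only [h]
    exact ⟨even_two, one_lt_two⟩
  · rintro ⟨i, j⟩ hij
    rw [integral_integral_legendreTerm]
    split_ifs with hc
    · simp only at hc ⊢
      by_cases hi : a < i
      · rw [integral_legendreP_mul_pow_eq_zero hi]; ring
      by_cases hj : b < j
      · rw [integral_legendreP_mul_pow_eq_zero hj]; ring
      exfalso
      apply hij
      rw [Prod.mk.injEq]
      omega
    · rfl

lemma integral_legendreKernel_mul_pow (hs : Summable fun ij => |legendreTerm α ij 1 1|) (τ : ℝ)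
    (b : ℕ) :
    ∫ σ in (0 : ℝ)..1, legendreKernel α τ σ * σ ^ b =
      (α 0 0 + τ / 2) / (b + 1) - 1 / (2 * (b + 2))
        + ∫ σ in (0 : ℝ)..1, legendreSum α τ σ * σ ^ b := by
  have hc : Continuous fun σ => legendreSum α τ σ :=
    (continuous_legendreSum hs).comp (by fun_prop : Continuous fun σ : ℝ => (τ, σ))
  have h1 : ∀ σ, legendreKernel α τ σ * σ ^ b = ((α 0 0 + τ / 2) * σ ^ b - 1 / 2 * σ ^ (b + 1))
      + legendreSum α τ σ * σ ^ b := by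
    intro σ
    rw [legendreKernel]
    ring
  simp only [h1]
  rw [intervalIntegral.integral_add (Continuous.intervalIntegrable (by fun_prop) _ _)
    (Continuous.intervalIntegrable (by fun_prop) _ _), intervalIntegral.integral_sub
    (Continuous.intervalIntegrable (by fun_prop) _ _)
    (Continuous.intervalIntegrable (by fun_prop) _ _), intervalIntegral.integral_const_mul,
    intervalIntegral.integral_const_mul, integral_pow, integral_pow]
  push_cast
  simp
  field_simp
  ring

lemma integral_integral_legendreKernel (hs : Summable fun ij => |legendreTerm α ij 1 1|)
    (a b : ℕ) :
    ∫ τ in (0 : ℝ)..1, τ ^ a * ∫ σ in (0 : ℝ)..1, legendreKernel α τ σ * σ ^ b =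
      (α 0 0 / (b + 1) - 1 / (2 * (b + 2))) / (a + 1) + 1 / (2 * (b + 1) * (a + 2))
        + ∫ τ in (0 : ℝ)..1, τ ^ a * ∫ σ in (0 : ℝ)..1, legendreSum α τ σ * σ ^ b := by
  have hc : Continuous fun τ => ∫ σ in (0 : ℝ)..1, legendreSum α τ σ * σ ^ b :=
    intervalIntegral.continuous_parametric_intervalIntegral_of_continuous'
      ((continuous_legendreSum hs).mul (continuous_snd.pow b)) 0 1
  have h1 : ∀ τ, τ ^ a * ∫ σ in (0 : ℝ)..1, legendreKernel α τ σ * σ ^ b =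
      ((α 0 0 / (b + 1) - 1 / (2 * (b + 2))) * τ ^ a + 1 / (2 * (b + 1)) * τ ^ (a + 1))
      + τ ^ a * ∫ σ in (0 : ℝ)..1, legendreSum α τ σ * σ ^ b := by
    intro τ
    rw [integral_legendreKernel_mul_pow hs]
    field_simp
    ring
  simp only [h1]
  rw [intervalIntegral.integral_add (Continuous.intervalIntegrable (by fun_prop) _ _)
    (Continuous.intervalIntegrable (by fun_prop) _ _), intervalIntegral.integral_add
    (Continuous.intervalIntegrable (by fun_prop) _ _)
    (Continuous.intervalIntegrable (by fun_prop) _ _), intervalIntegral.integral_const_mul,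
    intervalIntegral.integral_const_mul, integral_pow, integral_pow]
  push_cast
  simp
  field_simp
  ring

/-- The row integrals of the kernel when no `P_i` with `i > 2` contributes to them. -/
lemma integral_legendreKernel (hs : Summable fun ij => |legendreTerm α ij 1 1|)
    (h20 : α 2 0 = Real.sqrt 5 / 60) (hi0 : ∀ i : ℕ, Even i → 2 < i → α i 0 = 0)
    {τ : ℝ} (hτ : τ ∈ Icc (0 : ℝ) 1) :
    ∫ σ in (0 : ℝ)..1, legendreKernel α τ σ = α 0 0 - 1 / 6 + τ ^ 2 / 2 := by
  have h := eq_of_hasSum_of_forall_ne (hasSum_integral_legendreTerm hs 0 hτ) (2, 0) ?_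
  · have h2 := integral_legendreKernel_mul_pow hs τ 0
    have h5 : Real.sqrt 5 * Real.sqrt 5 = 5 := Real.mul_self_sqrt (by norm_num)
    rw [h, integral_legendreTerm_mul_pow, if_pos ⟨by simp, by simp⟩] at h2
    simp only [pow_zero, mul_one, legendreP_zero, legendreP_two, h20] at h2
    rw [h2]
    simp
    linear_combination ((6 * τ ^ 2 - 6 * τ + 1) / 60) * h5
  · rintro ⟨i, j⟩ hij
    rw [integral_legendreTerm_mul_pow]
    split_ifs with hc
    · simp only at hc ⊢
      by_cases hj : 0 < j
      · rw [integral_legendreP_mul_pow_eq_zero hj]; ring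
      obtain rfl : j = 0 := by omega
      have : i ≠ 2 := fun h => hij (by rw [h])
      rw [hi0 i (by simpa using hc.1) (by omega)]
      ring
    · rfl

end Kernel

/-! ### The defect of the kernel -/

/-- The kernel `(τ - σ)₊` with which the exact solution satisfies the stage equation. -/
noncomputable def exactKernel (τ σ : ℝ) : ℝ := max (τ - σ) 0

lemma continuous_exactKernel : Continuous (Function.uncurry exactKernel) := by
  simp only [Function.uncurry_def, exactKernel]
  fun_prop

lemma exactKernel_one_sub (τ σ : ℝ) :
    exactKernel (1 - τ) (1 - σ) = exactKernel τ σ - τ + σ := by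
  simp only [exactKernel]
  rcases le_total τ σ with h | h
  · rw [max_eq_left (by linarith), max_eq_right (by linarith)]; ring
  · rw [max_eq_right (by linarith), max_eq_left (by linarith)]; ring

lemma integral_exactKernel_smul {V : Type*} [NormedAddCommGroup V] [NormedSpace ℝ V]
    {g : ℝ → V} (hg : ContinuousOn g (Icc 0 1)) {τ : ℝ}
    (hτ : τ ∈ Icc (0 : ℝ) 1) :
    ∫ σ in (0 : ℝ)..1, exactKernel τ σ • g σ = ∫ σ in (0 : ℝ)..τ, (τ - σ) • g σ := by
  have hc : ContinuousOn (fun σ => exactKernel τ σ • g σ) (Icc 0 1) := by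
    unfold exactKernel
    fun_prop
  rw [← intervalIntegral.integral_add_adjacent_intervals (b := τ)
    (ContinuousOn.intervalIntegrable_of_Icc hτ.1 (hc.mono (Icc_subset_Icc_right hτ.2)))
    (ContinuousOn.intervalIntegrable_of_Icc hτ.2 (hc.mono (Icc_subset_Icc_left hτ.1)))]
  have h1 : ∫ σ in τ..1, exactKernel τ σ • g σ = 0 := by
    refine (intervalIntegral.integral_congr fun σ hσ => ?_).trans intervalIntegral.integral_zero
    rw [uIcc_of_le hτ.2] at hσ
    simp [exactKernel, max_eq_right (sub_nonpos.2 hσ.1)]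
  rw [h1, add_zero]
  refine intervalIntegral.integral_congr fun σ hσ => ?_
  rw [uIcc_of_le hτ.1] at hσ
  simp [exactKernel, max_eq_left (sub_nonneg.2 hσ.2)]

lemma integral_exactKernel_mul_pow (b : ℕ) {τ : ℝ} (hτ : τ ∈ Icc (0 : ℝ) 1) :
    ∫ σ in (0 : ℝ)..1, exactKernel τ σ * σ ^ b = τ ^ (b + 2) / ((b + 1) * (b + 2)) := by
  have h := integral_exactKernel_smul (g := fun σ : ℝ => σ ^ b) (by fun_prop) hτ
  simp only [smul_eq_mul] at h
  rw [h]
  have h1 : ∀ σ : ℝ, (τ - σ) * σ ^ b = τ * σ ^ b - σ ^ (b + 1) := fun σ => by ring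
  simp only [h1]
  rw [intervalIntegral.integral_sub (Continuous.intervalIntegrable (by fun_prop) _ _)
    (Continuous.intervalIntegrable (by fun_prop) _ _), intervalIntegral.integral_const_mul,
    integral_pow, integral_pow]
  push_cast
  simp
  field_simp
  ring

/-- The defect `D(τ, σ) = (τ - σ)₊ - A(τ, σ)` of a kernel. -/
noncomputable def defect (A : ℝ → ℝ → ℝ) (τ σ : ℝ) : ℝ := exactKernel τ σ - A τ σ

/-- The partial moments `∫ D(τ, σ) σ^b dσ` of the defect. -/
noncomputable def defectMoment (A : ℝ → ℝ → ℝ) (b : ℕ) (τ : ℝ) : ℝ :=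
  ∫ σ in (0 : ℝ)..1, defect A τ σ * σ ^ b

section Moments

variable {A : ℝ → ℝ → ℝ}

lemma continuous_defect (hA : Continuous (Function.uncurry A)) :
    Continuous (Function.uncurry (defect A)) :=
  continuous_exactKernel.sub hA

lemma continuous_defectMoment (hA : Continuous (Function.uncurry A)) (b : ℕ) :
    Continuous (defectMoment A b) :=
  intervalIntegral.continuous_parametric_intervalIntegral_of_continuous'
    ((continuous_defect hA).mul (continuous_snd.pow b)) 0 1

lemma defectMoment_eq (hA : Continuous (Function.uncurry A)) (b : ℕ) {τ : ℝ}
    (hτ : τ ∈ Icc (0 : ℝ) 1) :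
    defectMoment A b τ =
      τ ^ (b + 2) / ((b + 1) * (b + 2)) - ∫ σ in (0 : ℝ)..1, A τ σ * σ ^ b := by
  rw [← integral_exactKernel_mul_pow b hτ, defectMoment]
  have h1 : Continuous fun σ => A τ σ := hA.comp (by fun_prop : Continuous fun σ : ℝ => (τ, σ))
  have h2 : Continuous fun σ => exactKernel τ σ :=
    continuous_exactKernel.comp (by fun_prop : Continuous fun σ : ℝ => (τ, σ))
  simp only [defect, sub_mul]
  exact intervalIntegral.integral_sub (Continuous.intervalIntegrable (by fun_prop) _ _)
    (Continuous.intervalIntegrable (by fun_prop) _ _)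

lemma integral_mul_defectMoment (hA : Continuous (Function.uncurry A)) (a b : ℕ) :
    ∫ τ in (0 : ℝ)..1, τ ^ a * defectMoment A b τ =
      1 / ((b + 1) * (b + 2) * (a + b + 3))
        - ∫ τ in (0 : ℝ)..1, τ ^ a * ∫ σ in (0 : ℝ)..1, A τ σ * σ ^ b := by
  have hc : Continuous fun τ => ∫ σ in (0 : ℝ)..1, A τ σ * σ ^ b :=
    intervalIntegral.continuous_parametric_intervalIntegral_of_continuous'
      (hA.mul (continuous_snd.pow b)) 0 1
  have h1 : ∫ τ in (0 : ℝ)..1, τ ^ a * defectMoment A b τ =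
      ∫ τ in (0 : ℝ)..1, (1 / (((b : ℝ) + 1) * (b + 2)) * τ ^ (a + b + 2)
        - τ ^ a * ∫ σ in (0 : ℝ)..1, A τ σ * σ ^ b) := by
    refine intervalIntegral.integral_congr fun τ hτ => ?_
    rw [uIcc_of_le zero_le_one] at hτ
    simp only [defectMoment_eq hA b hτ]
    ring
  rw [h1, intervalIntegral.integral_sub (Continuous.intervalIntegrable (by fun_prop) _ _)
    (Continuous.intervalIntegrable (by fun_prop) _ _), intervalIntegral.integral_const_mul,
    integral_pow]
  push_cast
  simp
  field_simp
  ring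

/-- A kernel with `A(1 - τ, 1 - σ) = A(τ, σ) - τ + σ` on the unit square. The kernel of the exact
solution is of this kind, and a method with `B = 1`, `C_τ = τ` is symmetric if its kernel is. -/
def IsSymmetricKernel (A : ℝ → ℝ → ℝ) : Prop :=
  ∀ τ ∈ Icc (0 : ℝ) 1, ∀ σ ∈ Icc (0 : ℝ) 1, A (1 - τ) (1 - σ) = A τ σ - τ + σ

lemma integral_comp_one_sub {V : Type*} [NormedAddCommGroup V] [NormedSpace ℝ V] (g : ℝ → V) :
    ∫ x in (0 : ℝ)..1, g (1 - x) = ∫ x in (0 : ℝ)..1, g x := by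
  simp

lemma defectMoment_one_sub (hs : IsSymmetricKernel A) (b : ℕ) {τ : ℝ} (hτ : τ ∈ Icc (0 : ℝ) 1) :
    defectMoment A b (1 - τ) = ∫ σ in (0 : ℝ)..1, defect A τ σ * (1 - σ) ^ b := by
  rw [defectMoment, ← integral_comp_one_sub]
  refine intervalIntegral.integral_congr fun σ hσ => ?_
  rw [uIcc_of_le zero_le_one] at hσ
  simp only [defect, exactKernel_one_sub, hs τ hτ σ hσ]
  ring

lemma intervalIntegrable_defect_mul_pow (hA : Continuous (Function.uncurry A)) (τ : ℝ) (b : ℕ) :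
    IntervalIntegrable (fun σ => defect A τ σ * σ ^ b) volume 0 1 := by
  have h1 : Continuous fun σ => defect A τ σ :=
    (continuous_defect hA).comp (by fun_prop : Continuous fun σ : ℝ => (τ, σ))
  exact Continuous.intervalIntegrable (by fun_prop) _ _

lemma defectMoment_zero_one_sub (hs : IsSymmetricKernel A) {τ : ℝ} (hτ : τ ∈ Icc (0 : ℝ) 1) :
    defectMoment A 0 (1 - τ) = defectMoment A 0 τ := by
  rw [defectMoment_one_sub hs 0 hτ]
  simp [defectMoment]

lemma defectMoment_one_one_sub (hA : Continuous (Function.uncurry A)) (hs : IsSymmetricKernel A)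
    {τ : ℝ} (hτ : τ ∈ Icc (0 : ℝ) 1) :
    defectMoment A 1 (1 - τ) = defectMoment A 0 τ - defectMoment A 1 τ := by
  rw [defectMoment_one_sub hs 1 hτ, defectMoment, defectMoment,
    ← intervalIntegral.integral_sub (intervalIntegrable_defect_mul_pow hA τ 0)
      (intervalIntegrable_defect_mul_pow hA τ 1)]
  congr 1 with σ
  ring

lemma defectMoment_two_one_sub (hA : Continuous (Function.uncurry A)) (hs : IsSymmetricKernel A)
    {τ : ℝ} (hτ : τ ∈ Icc (0 : ℝ) 1) :
    defectMoment A 2 (1 - τ) =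
      defectMoment A 0 τ - 2 * defectMoment A 1 τ + defectMoment A 2 τ := by
  have h := intervalIntegrable_defect_mul_pow hA τ
  rw [defectMoment_one_sub hs 2 hτ, defectMoment, defectMoment, defectMoment,
    ← intervalIntegral.integral_const_mul,
    ← intervalIntegral.integral_sub (h 0) ((h 1).const_mul 2),
    ← intervalIntegral.integral_add ((h 0).sub ((h 1).const_mul 2)) (h 2)]
  congr 1 with σ
  ring

lemma defectMoment_three_one_sub (hA : Continuous (Function.uncurry A)) (hs : IsSymmetricKernel A)
    {τ : ℝ} (hτ : τ ∈ Icc (0 : ℝ) 1) :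
    defectMoment A 3 (1 - τ) = defectMoment A 0 τ - 3 * defectMoment A 1 τ
      + 3 * defectMoment A 2 τ - defectMoment A 3 τ := by
  have h := intervalIntegrable_defect_mul_pow hA τ
  rw [defectMoment_one_sub hs 3 hτ, defectMoment, defectMoment, defectMoment, defectMoment,
    ← intervalIntegral.integral_const_mul, ← intervalIntegral.integral_const_mul,
    ← intervalIntegral.integral_sub (h 0) ((h 1).const_mul 3),
    ← intervalIntegral.integral_add ((h 0).sub ((h 1).const_mul 3)) ((h 2).const_mul 3),
    ← intervalIntegral.integral_sub
      (((h 0).sub ((h 1).const_mul 3)).add ((h 2).const_mul 3)) (h 3)]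
  congr 1 with σ
  ring

/-- The moments `∫∫ τ^a D(τ, σ) σ^b` of the defect vanish for `a + b < n`. -/
def DefectMomentsVanish (A : ℝ → ℝ → ℝ) (n : ℕ) : Prop :=
  ∀ a b : ℕ, a + b < n → ∫ τ in (0 : ℝ)..1, τ ^ a * defectMoment A b τ = 0

/-- By symmetry, the moments of degree `1` vanish with that of degree `0`. -/
lemma defectMomentsVanish_two (hA : Continuous (Function.uncurry A)) (hs : IsSymmetricKernel A)
    (h00 : ∫ τ in (0 : ℝ)..1, τ ^ 0 * defectMoment A 0 τ = 0) : DefectMomentsVanish A 2 := by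
  have c0 := continuous_defectMoment hA 0
  have c1 := continuous_defectMoment hA 1
  simp only [pow_zero, one_mul] at h00
  have h01 : ∫ τ in (0 : ℝ)..1, τ ^ 0 * defectMoment A 1 τ = 0 := by
    have h : ∫ τ in (0 : ℝ)..1, defectMoment A 1 τ
        = ∫ τ in (0 : ℝ)..1, (defectMoment A 0 τ - defectMoment A 1 τ) := by
      rw [← integral_comp_one_sub]
      refine intervalIntegral.integral_congr fun τ hτ => ?_
      rw [uIcc_of_le zero_le_one] at hτ
      exact defectMoment_one_one_sub hA hs hτ
    rw [intervalIntegral.integral_sub (c0.intervalIntegrable _ _) (c1.intervalIntegrable _ _)] at h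
    simp only [pow_zero, one_mul]
    linarith
  have h10 : ∫ τ in (0 : ℝ)..1, τ ^ 1 * defectMoment A 0 τ = 0 := by
    have h : ∫ τ in (0 : ℝ)..1, τ ^ 1 * defectMoment A 0 τ
        = ∫ τ in (0 : ℝ)..1, (defectMoment A 0 τ - τ ^ 1 * defectMoment A 0 τ) := by
      rw [← integral_comp_one_sub]
      refine intervalIntegral.integral_congr fun τ hτ => ?_
      rw [uIcc_of_le zero_le_one] at hτ
      simp only [defectMoment_zero_one_sub hs hτ]
      ring
    rw [intervalIntegral.integral_sub (c0.intervalIntegrable _ _)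
      (Continuous.intervalIntegrable (by fun_prop) _ _)] at h
    linarith
  intro a b hab
  obtain ⟨rfl, rfl⟩ | ⟨rfl, rfl⟩ | ⟨rfl, rfl⟩ :
      (a = 0 ∧ b = 0) ∨ (a = 0 ∧ b = 1) ∨ (a = 1 ∧ b = 0) := by omega
  · simpa using h00
  · exact h01
  · exact h10

/-- If the row integrals of the defect vanish, then by symmetry its moments of degree `3` vanish
with those of degree `2`. -/
lemma defectMomentsVanish_four (hA : Continuous (Function.uncurry A)) (hs : IsSymmetricKernel A)
    (h0 : ∀ τ ∈ Icc (0 : ℝ) 1, defectMoment A 0 τ = 0)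
    (h11 : ∫ τ in (0 : ℝ)..1, τ ^ 1 * defectMoment A 1 τ = 0)
    (h02 : ∫ τ in (0 : ℝ)..1, τ ^ 0 * defectMoment A 2 τ = 0) : DefectMomentsVanish A 4 := by
  have c1 := continuous_defectMoment hA 1
  have c2 := continuous_defectMoment hA 2
  have c3 := continuous_defectMoment hA 3
  have hb0 : ∀ a, ∫ τ in (0 : ℝ)..1, τ ^ a * defectMoment A 0 τ = 0 := by
    intro a
    refine (intervalIntegral.integral_congr fun τ hτ => ?_).trans intervalIntegral.integral_zero
    rw [uIcc_of_le zero_le_one] at hτ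
    simp only [h0 τ hτ, mul_zero]
  have h01 := defectMomentsVanish_two hA hs (hb0 0) 0 1 (by norm_num)
  have ii : ∀ {φ : ℝ → ℝ}, Continuous φ → IntervalIntegrable φ volume 0 1 :=
    fun h => h.intervalIntegrable _ _
  simp only [pow_zero, one_mul] at h01 h02
  have h03 : ∫ τ in (0 : ℝ)..1, τ ^ 0 * defectMoment A 3 τ = 0 := by
    have h : ∫ τ in (0 : ℝ)..1, defectMoment A 3 τ = ∫ τ in (0 : ℝ)..1,
        (3 * defectMoment A 2 τ - 3 * defectMoment A 1 τ - defectMoment A 3 τ) := by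
      rw [← integral_comp_one_sub]
      refine intervalIntegral.integral_congr fun τ hτ => ?_
      rw [uIcc_of_le zero_le_one] at hτ
      simp only [defectMoment_three_one_sub hA hs hτ, h0 τ hτ]
      ring
    rw [intervalIntegral.integral_sub (ii (by fun_prop)) (ii (by fun_prop)),
      intervalIntegral.integral_sub (ii (by fun_prop)) (ii (by fun_prop)),
      intervalIntegral.integral_const_mul, intervalIntegral.integral_const_mul, h01, h02] at h
    simp only [pow_zero, one_mul]
    linarith
  have h12 : ∫ τ in (0 : ℝ)..1, τ ^ 1 * defectMoment A 2 τ = 0 := by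
    have h : ∫ τ in (0 : ℝ)..1, τ ^ 1 * defectMoment A 2 τ = ∫ τ in (0 : ℝ)..1,
        (2 * (τ ^ 1 * defectMoment A 1 τ) - 2 * defectMoment A 1 τ + defectMoment A 2 τ
          - τ ^ 1 * defectMoment A 2 τ) := by
      rw [← integral_comp_one_sub]
      refine intervalIntegral.integral_congr fun τ hτ => ?_
      rw [uIcc_of_le zero_le_one] at hτ
      simp only [defectMoment_two_one_sub hA hs hτ, h0 τ hτ]
      ring
    rw [intervalIntegral.integral_sub (ii (by fun_prop)) (ii (by fun_prop)),
      intervalIntegral.integral_add (ii (by fun_prop)) (ii (by fun_prop)),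
      intervalIntegral.integral_sub (ii (by fun_prop)) (ii (by fun_prop)),
      intervalIntegral.integral_const_mul, intervalIntegral.integral_const_mul, h01, h02, h11] at h
    linarith
  have h21 : ∫ τ in (0 : ℝ)..1, τ ^ 2 * defectMoment A 1 τ = 0 := by
    have h : ∫ τ in (0 : ℝ)..1, τ ^ 2 * defectMoment A 1 τ = ∫ τ in (0 : ℝ)..1,
        (2 * (τ ^ 1 * defectMoment A 1 τ) - defectMoment A 1 τ
          - τ ^ 2 * defectMoment A 1 τ) := by
      rw [← integral_comp_one_sub]
      refine intervalIntegral.integral_congr fun τ hτ => ?_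
      rw [uIcc_of_le zero_le_one] at hτ
      simp only [defectMoment_one_one_sub hA hs hτ, h0 τ hτ]
      ring
    rw [intervalIntegral.integral_sub (ii (by fun_prop)) (ii (by fun_prop)),
      intervalIntegral.integral_sub (ii (by fun_prop)) (ii (by fun_prop)),
      intervalIntegral.integral_const_mul, h01, h11] at h
    linarith
  intro a b hab
  rcases b with _ | b
  · exact hb0 a
  obtain ⟨rfl, rfl⟩ | ⟨rfl, rfl⟩ | ⟨rfl, rfl⟩ | ⟨rfl, rfl⟩ | ⟨rfl, rfl⟩ | ⟨rfl, rfl⟩ :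
      (a = 0 ∧ b = 0) ∨ (a = 0 ∧ b = 1) ∨ (a = 0 ∧ b = 2) ∨ (a = 1 ∧ b = 0) ∨ (a = 1 ∧ b = 1) ∨
        (a = 2 ∧ b = 0) := by omega
  · simpa using h01
  · simpa using h02
  · exact h03
  · exact h11
  · exact h12
  · exact h21

/-- The column integrals `w(τ) = ∫ A(ρ, τ) dρ` satisfy `w(1 - τ) = w(τ) - 1/2 + τ`, while
`∫ D(τ, σ) σ dσ` is odd about `1/2`; so the two are orthogonal. -/
lemma integral_column_mul_defectMoment_one (hA : Continuous (Function.uncurry A))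
    (hs : IsSymmetricKernel A) (h0 : ∀ τ ∈ Icc (0 : ℝ) 1, defectMoment A 0 τ = 0)
    (h : DefectMomentsVanish A 4) :
    ∫ τ in (0 : ℝ)..1, (∫ ρ in (0 : ℝ)..1, A ρ τ) * defectMoment A 1 τ = 0 := by
  have c1 := continuous_defectMoment hA 1
  have cw : Continuous fun τ => ∫ ρ in (0 : ℝ)..1, A ρ τ :=
    intervalIntegral.continuous_parametric_intervalIntegral_of_continuous'
      (f := fun τ ρ => A ρ τ) (hA.comp continuous_swap) 0 1
  have ii : ∀ {φ : ℝ → ℝ}, Continuous φ → IntervalIntegrable φ volume 0 1 :=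
    fun h => h.intervalIntegrable _ _
  have hw : ∀ τ ∈ Icc (0 : ℝ) 1,
      ∫ ρ in (0 : ℝ)..1, A ρ (1 - τ) = (∫ ρ in (0 : ℝ)..1, A ρ τ) - 1 / 2 + τ := by
    intro τ hτ
    have hc : Continuous fun ρ => A ρ τ := hA.comp (by fun_prop : Continuous fun ρ : ℝ => (ρ, τ))
    rw [← integral_comp_one_sub]
    have : ∫ ρ in (0 : ℝ)..1, A (1 - ρ) (1 - τ) = ∫ ρ in (0 : ℝ)..1, (A ρ τ - ρ + τ) := by
      refine intervalIntegral.integral_congr fun ρ hρ => ?_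
      rw [uIcc_of_le zero_le_one] at hρ
      exact hs ρ hρ τ hτ
    rw [this, intervalIntegral.integral_add (ii (by fun_prop)) (ii (by fun_prop)),
      intervalIntegral.integral_sub (ii (by fun_prop)) (ii (by fun_prop))]
    simp
  have h01 := h 0 1 (by norm_num)
  have h11 := h 1 1 (by norm_num)
  simp only [pow_zero, one_mul] at h01
  have h2 : ∫ τ in (0 : ℝ)..1, (∫ ρ in (0 : ℝ)..1, A ρ τ) * defectMoment A 1 τ =
      ∫ τ in (0 : ℝ)..1, (1 / 2 * defectMoment A 1 τ - τ ^ 1 * defectMoment A 1 τ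
        - (∫ ρ in (0 : ℝ)..1, A ρ τ) * defectMoment A 1 τ) := by
    rw [← integral_comp_one_sub]
    refine intervalIntegral.integral_congr fun τ hτ => ?_
    rw [uIcc_of_le zero_le_one] at hτ
    simp only [hw τ hτ, defectMoment_one_one_sub hA hs hτ, h0 τ hτ]
    ring
  rw [intervalIntegral.integral_sub (ii (by fun_prop)) (ii (by fun_prop)),
    intervalIntegral.integral_sub (ii (by fun_prop)) (ii (by fun_prop)),
    intervalIntegral.integral_const_mul, h01, h11] at h2
  linarith

end Moments

section LegendreDefect

variable {α : ℕ → ℕ → ℝ}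

lemma isSymmetricKernel_legendreKernel : IsSymmetricKernel (legendreKernel α) :=
  fun _ hτ _ hσ => legendreKernel_one_sub hτ hσ

lemma defectMomentsVanish_two_legendreKernel (hs : Summable fun ij => |legendreTerm α ij 1 1|)
    (h00 : α 0 0 = 1 / 6) : DefectMomentsVanish (legendreKernel α) 2 := by
  refine defectMomentsVanish_two (continuous_legendreKernel hs) isSymmetricKernel_legendreKernel ?_
  rw [integral_mul_defectMoment (continuous_legendreKernel hs), integral_integral_legendreKernel hs,
    integral_integral_legendreSum hs 0 0 (by norm_num), h00]
  norm_num

lemma defectMoment_zero_legendreKernel (hs : Summable fun ij => |legendreTerm α ij 1 1|)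
    (h00 : α 0 0 = 1 / 6) (h20 : α 2 0 = Real.sqrt 5 / 60)
    (hi0 : ∀ i : ℕ, Even i → 2 < i → α i 0 = 0) {τ : ℝ} (hτ : τ ∈ Icc (0 : ℝ) 1) :
    defectMoment (legendreKernel α) 0 τ = 0 := by
  rw [defectMoment_eq (continuous_legendreKernel hs) 0 hτ]
  simp only [pow_zero, mul_one]
  rw [integral_legendreKernel hs h20 hi0 hτ, h00]
  norm_num

lemma defectMomentsVanish_four_legendreKernel (hs : Summable fun ij => |legendreTerm α ij 1 1|)
    (h00 : α 0 0 = 1 / 6) (h11 : α 1 1 = -1 / 10) (h20 : α 2 0 = Real.sqrt 5 / 60)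
    (h02 : α 0 2 = Real.sqrt 5 / 60) (hi0 : ∀ i : ℕ, Even i → 2 < i → α i 0 = 0) :
    DefectMomentsVanish (legendreKernel α) 4 := by
  have hA := continuous_legendreKernel hs
  refine defectMomentsVanish_four hA isSymmetricKernel_legendreKernel
    (fun τ hτ => defectMoment_zero_legendreKernel hs h00 h20 hi0 hτ) ?_ ?_
  · have h1 : ∫ τ in (0 : ℝ)..1, legendreP 1 τ * τ ^ 1 = Real.sqrt 3 / 6 := by
      have : ∀ τ : ℝ, legendreP 1 τ * τ ^ 1 = Real.sqrt 3 * (2 * τ ^ 2 - τ) := fun τ => by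
        rw [legendreP_one]; ring
      simp only [this]
      rw [intervalIntegral.integral_const_mul, intervalIntegral.integral_sub
        (Continuous.intervalIntegrable (by fun_prop) _ _)
        (Continuous.intervalIntegrable (by fun_prop) _ _), intervalIntegral.integral_const_mul,
        integral_pow, integral_id]
      norm_num
      ring
    have h3 : Real.sqrt 3 * Real.sqrt 3 = 3 := Real.mul_self_sqrt (by norm_num)
    rw [integral_mul_defectMoment hA, integral_integral_legendreKernel hs,
      integral_integral_legendreSum hs 1 1 (by norm_num), if_pos (by norm_num), h00, h11, h1]
    push_cast
    linear_combination (1 / 360) * h3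
  · have h1 : ∫ τ in (0 : ℝ)..1, legendreP 2 τ * τ ^ 2 = Real.sqrt 5 / 30 := by
      have : ∀ τ : ℝ, legendreP 2 τ * τ ^ 2
          = Real.sqrt 5 * (6 * τ ^ 4 - 6 * τ ^ 3 + τ ^ 2) := fun τ => by
        rw [legendreP_two]; ring
      simp only [this]
      rw [intervalIntegral.integral_const_mul, intervalIntegral.integral_add
        (Continuous.intervalIntegrable (by fun_prop) _ _)
        (Continuous.intervalIntegrable (by fun_prop) _ _), intervalIntegral.integral_sub
        (Continuous.intervalIntegrable (by fun_prop) _ _)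
        (Continuous.intervalIntegrable (by fun_prop) _ _), intervalIntegral.integral_const_mul,
        intervalIntegral.integral_const_mul, integral_pow, integral_pow, integral_pow]
      norm_num
      ring
    have h5 : Real.sqrt 5 * Real.sqrt 5 = 5 := Real.mul_self_sqrt (by norm_num)
    rw [integral_mul_defectMoment hA, integral_integral_legendreKernel hs,
      integral_integral_legendreSum hs 0 2 (by norm_num), if_pos (by norm_num), h00, h02, h1]
    simp only [legendreP_zero, pow_zero, mul_one]
    simp
    linear_combination (-1 / 1800) * h5

end LegendreDefect

/-! ### Uniform asymptotics and local expansions -/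

section Asymptotics

variable {V W : Type*} [NormedAddCommGroup V]

/-- `φ(h, τ) = O(h^n)` as `h → 0`, uniformly in `τ ∈ [0, 1]`. -/
def IsUniformO (φ : ℝ → ℝ → V) (n : ℕ) : Prop :=
  ∃ C : ℝ, ∀ᶠ h in 𝓝 (0 : ℝ), ∀ τ ∈ Icc (0 : ℝ) 1, ‖φ h τ‖ ≤ C * |h| ^ n

lemma IsUniformO.exists_nonneg {φ : ℝ → ℝ → V} {n : ℕ} (hφ : IsUniformO φ n) :
    ∃ C : ℝ, 0 ≤ C ∧ ∀ᶠ h in 𝓝 (0 : ℝ), ∀ τ ∈ Icc (0 : ℝ) 1, ‖φ h τ‖ ≤ C * |h| ^ n := by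
  obtain ⟨C, hC⟩ := hφ
  refine ⟨max C 0, le_max_right _ _, hC.mono fun h hh τ hτ => (hh τ hτ).trans ?_⟩
  gcongr
  exact le_max_left _ _

lemma IsUniformO.congr {φ ψ : ℝ → ℝ → V} {n : ℕ} (hφ : IsUniformO φ n)
    (h : ∀ᶠ h in 𝓝 (0 : ℝ), ∀ τ ∈ Icc (0 : ℝ) 1, ψ h τ = φ h τ) : IsUniformO ψ n := by
  obtain ⟨C, hC⟩ := hφ
  refine ⟨C, ?_⟩
  filter_upwards [hC, h] with h h1 h2 τ hτ
  rw [h2 τ hτ]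
  exact h1 τ hτ

lemma IsUniformO.add {φ ψ : ℝ → ℝ → V} {n : ℕ} (hφ : IsUniformO φ n) (hψ : IsUniformO ψ n) :
    IsUniformO (fun h τ => φ h τ + ψ h τ) n := by
  obtain ⟨C, hC⟩ := hφ
  obtain ⟨C', hC'⟩ := hψ
  refine ⟨C + C', ?_⟩
  filter_upwards [hC, hC'] with h h1 h2 τ hτ
  rw [add_mul]
  exact (norm_add_le _ _).trans (add_le_add (h1 τ hτ) (h2 τ hτ))

lemma isUniformO_sum {ι : Type*} (s : Finset ι) {φ : ι → ℝ → ℝ → V} {n : ℕ}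
    (hφ : ∀ i ∈ s, IsUniformO (φ i) n) : IsUniformO (fun h τ => ∑ i ∈ s, φ i h τ) n := by
  classical
  induction s using Finset.induction_on with
  | empty => exact ⟨0, .of_forall fun h τ _ => by simp⟩
  | insert i s hi ih =>
    simp only [Finset.sum_insert hi]
    exact (hφ i (Finset.mem_insert_self _ _)).add
      (ih fun j hj => hφ j (Finset.mem_insert_of_mem hj))

lemma IsUniformO.of_sub {φ ψ : ℝ → ℝ → V} {n : ℕ} (h : IsUniformO (fun h τ => φ h τ - ψ h τ) n)
    (hψ : IsUniformO ψ n) : IsUniformO φ n :=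
  (h.add hψ).congr (.of_forall fun h τ _ => by simp)

lemma IsUniformO.mono {φ : ℝ → ℝ → V} {m n : ℕ} (hφ : IsUniformO φ n) (hmn : m ≤ n) :
    IsUniformO φ m := by
  obtain ⟨C, hC0, hC⟩ := hφ.exists_nonneg
  refine ⟨C, ?_⟩
  filter_upwards [hC, Metric.ball_mem_nhds (0 : ℝ) one_pos] with h h1 h2 τ hτ
  rw [mem_ball_zero_iff, Real.norm_eq_abs] at h2
  refine (h1 τ hτ).trans ?_
  gcongr ?_ * ?_
  exact pow_le_pow_of_le_one (abs_nonneg h) h2.le hmn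

lemma isUniformO_zero_of_continuous {G : ℝ → V} (hG : Continuous G) :
    IsUniformO (fun h τ => G (h * τ)) 0 := by
  obtain ⟨B, hB⟩ := (isCompact_Icc (a := (-1 : ℝ)) (b := 1)).exists_bound_of_continuousOn
    hG.continuousOn
  refine ⟨B, ?_⟩
  filter_upwards [Metric.ball_mem_nhds (0 : ℝ) one_pos] with h hh τ hτ
  rw [mem_ball_zero_iff, Real.norm_eq_abs] at hh
  rw [pow_zero, mul_one]
  refine hB _ (abs_le.1 ?_)
  rw [abs_mul, abs_of_nonneg hτ.1]
  exact mul_le_one₀ hh.le hτ.1 hτ.2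

variable [NormedSpace ℝ V] [NormedAddCommGroup W] [NormedSpace ℝ W]

lemma IsUniformO.pow_smul {φ : ℝ → ℝ → V} {n : ℕ} (hφ : IsUniformO φ n) (k : ℕ) :
    IsUniformO (fun h τ => h ^ k • φ h τ) (k + n) := by
  obtain ⟨C, hC⟩ := hφ
  refine ⟨C, hC.mono fun h hh τ hτ => ?_⟩
  rw [norm_smul, norm_pow, Real.norm_eq_abs, pow_add, mul_left_comm]
  gcongr
  exact hh τ hτ

lemma IsUniformO.clm_apply {L : ℝ → ℝ → V →L[ℝ] W} {φ : ℝ → ℝ → V} {m n : ℕ}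
    (hL : IsUniformO L m) (hφ : IsUniformO φ n) :
    IsUniformO (fun h τ => L h τ (φ h τ)) (m + n) := by
  obtain ⟨C, hC0, hC⟩ := hL.exists_nonneg
  obtain ⟨C', hC'⟩ := hφ
  refine ⟨C * C', ?_⟩
  filter_upwards [hC, hC'] with h h1 h2 τ hτ
  calc ‖L h τ (φ h τ)‖ ≤ ‖L h τ‖ * ‖φ h τ‖ := (L h τ).le_opNorm _
    _ ≤ (C * |h| ^ m) * (C' * |h| ^ n) :=
        mul_le_mul (h1 τ hτ) (h2 τ hτ) (norm_nonneg _) (by positivity)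
    _ = C * C' * |h| ^ (m + n) := by rw [pow_add]; ring

/-- Integration against a continuous kernel preserves uniform orders. -/
lemma IsUniformO.integral_kernel {K : ℝ → ℝ → ℝ} (hK : Continuous (Function.uncurry K))
    {φ : ℝ → ℝ → V} {n : ℕ} (hφ : IsUniformO φ n) :
    IsUniformO (fun h τ => ∫ σ in (0 : ℝ)..1, K τ σ • φ h σ) n := by
  obtain ⟨C, hC⟩ := hφ
  obtain ⟨B, hB⟩ := ((isCompact_Icc.prod isCompact_Icc).exists_bound_of_continuousOn
    (s := Icc (0 : ℝ) 1 ×ˢ Icc (0 : ℝ) 1) hK.continuousOn)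
  have hB0 : 0 ≤ B := (norm_nonneg _).trans
    (hB (0, 0) ⟨left_mem_Icc.2 zero_le_one, left_mem_Icc.2 zero_le_one⟩)
  refine ⟨B * C, hC.mono fun h hh τ hτ => ?_⟩
  have := intervalIntegral.norm_integral_le_of_norm_le_const (a := (0 : ℝ)) (b := 1)
    (f := fun σ => K τ σ • φ h σ) (C := B * (C * |h| ^ n)) fun σ hσ => by
      rw [uIoc_of_le zero_le_one] at hσ
      have hσ' := Ioc_subset_Icc_self hσ
      rw [norm_smul]
      exact mul_le_mul (hB (τ, σ) ⟨hτ, hσ'⟩) (hh σ hσ') (norm_nonneg _) hB0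
  simpa [mul_assoc] using this

lemma IsUniformO.integral {u : ℝ → ℝ} (hu : Continuous u)
    {φ : ℝ → ℝ → V} {n : ℕ} (hφ : IsUniformO φ n) :
    IsUniformO (fun h _ => ∫ τ in (0 : ℝ)..1, u τ • φ h τ) n :=
  hφ.integral_kernel (K := fun _ τ => u τ) (hu.comp continuous_snd)

lemma IsUniformO.integral_of_sub {u : ℝ → ℝ} (hu : Continuous u)
    {φ ψ : ℝ → ℝ → V} {n : ℕ} (hφ : ∀ h, Continuous (φ h)) (hψ : ∀ h, Continuous (ψ h))
    (h : IsUniformO (fun h τ => φ h τ - ψ h τ) n)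
    (hi : IsUniformO (fun h _ => ∫ τ in (0 : ℝ)..1, u τ • ψ h τ) n) :
    IsUniformO (fun h _ => ∫ τ in (0 : ℝ)..1, u τ • φ h τ) n := by
  refine ((h.integral hu).congr (.of_forall fun h _ _ => ?_)).of_sub hi
  have := hφ h
  have := hψ h
  simp only [smul_sub]
  exact (intervalIntegral.integral_sub (Continuous.intervalIntegrable (by fun_prop) _ _)
    (Continuous.intervalIntegrable (by fun_prop) _ _)).symm

/-- `G` has a Taylor expansion of order `n` at `0`, with remainder `O(s^n)`. -/
def HasExpansion (G : ℝ → V) (n : ℕ) : Prop :=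
  ∃ (c : ℕ → V) (C : ℝ), ∀ᶠ s in 𝓝 (0 : ℝ), ‖G s - ∑ k ∈ Finset.range n, s ^ k • c k‖ ≤ C * |s| ^ n

lemma hasExpansion_const (v : V) (n : ℕ) : HasExpansion (fun _ => v) n := by
  rcases n with _ | n
  · exact ⟨0, ‖v‖, .of_forall fun s => by simp⟩
  · refine ⟨fun k => if k = 0 then v else 0, 0, .of_forall fun s => ?_⟩
    simp

lemma HasExpansion.clm_apply_const {L : ℝ → V →L[ℝ] W} {n : ℕ} (hL : HasExpansion L n) (v : V) :
    HasExpansion (fun s => L s v) n := by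
  obtain ⟨c, C, hC⟩ := hL
  refine ⟨fun k => c k v, C * ‖v‖, hC.mono fun s hs => ?_⟩
  have h1 : L s v - ∑ k ∈ Finset.range n, s ^ k • c k v
      = (L s - ∑ k ∈ Finset.range n, s ^ k • c k) v := by
    simp
  rw [h1]
  calc _ ≤ ‖L s - ∑ k ∈ Finset.range n, s ^ k • c k‖ * ‖v‖ :=
        ContinuousLinearMap.le_opNorm _ _
    _ ≤ C * |s| ^ n * ‖v‖ := by gcongr
    _ = C * ‖v‖ * |s| ^ n := by ring

lemma HasExpansion.isUniformO {G : ℝ → V} {n : ℕ} (hG : HasExpansion G n) :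
    ∃ c : ℕ → V, IsUniformO
      (fun h τ => G (h * τ) - ∑ k ∈ Finset.range n, (h * τ) ^ k • c k) n := by
  obtain ⟨c, C, hC⟩ := hG
  obtain ⟨δ, hδ, hball⟩ := Metric.eventually_nhds_iff_ball.1 hC
  refine ⟨c, max C 0, ?_⟩
  filter_upwards [Metric.ball_mem_nhds (0 : ℝ) hδ] with h hh τ hτ
  rw [mem_ball_zero_iff, Real.norm_eq_abs] at hh
  have hle : |h * τ| ≤ |h| := by
    rw [abs_mul, abs_of_nonneg hτ.1]
    exact mul_le_of_le_one_right (abs_nonneg _) hτ.2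
  refine (hball (h * τ) ?_).trans ?_
  · rw [mem_ball_zero_iff, Real.norm_eq_abs]
    exact hle.trans_lt hh
  · gcongr
    exact le_max_left _ _

lemma isUniformO_sub_zero {G : ℝ → V} (hG : HasExpansion G 1) :
    IsUniformO (fun h τ => G (h * τ) - G 0) 1 := by
  obtain ⟨c, C, hC⟩ := hG.isUniformO
  have h0 : G 0 = c 0 := by
    have := hC.self_of_nhds 0 (left_mem_Icc.2 zero_le_one)
    simpa [sub_eq_zero] using this
  exact ⟨C, by simpa [h0] using hC⟩

/-- A weight orthogonal to all polynomials of degree less than `n` integrates smooth functions of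
`h τ` to `O(h^n)`. -/
lemma HasExpansion.isUniformO_integral [CompleteSpace V] {G : ℝ → V} {n : ℕ} (hG : HasExpansion G n)
    (hGc : Continuous G) {w : ℝ → ℝ} (hw : Continuous w)
    (h0 : ∀ k < n, ∫ τ in (0 : ℝ)..1, w τ * τ ^ k = 0) :
    IsUniformO (fun h _ => ∫ τ in (0 : ℝ)..1, w τ • G (h * τ)) n := by
  obtain ⟨c, hc⟩ := hG.isUniformO
  refine IsUniformO.integral_of_sub hw (fun h => by fun_prop) (fun h => by fun_prop) hc ?_
  refine ⟨0, .of_forall fun h τ _ => ?_⟩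
  simp only [Finset.smul_sum]
  rw [intervalIntegral.integral_finsetSum
    fun k _ => Continuous.intervalIntegrable (by fun_prop) _ _, Finset.sum_eq_zero]
  · simp
  · intro k hk
    have h1 : ∀ τ : ℝ, w τ • (h * τ) ^ k • c k = (w τ * τ ^ k) • h ^ k • c k := fun τ => by
      rw [smul_smul, smul_smul, mul_pow]
      congr 1
      ring
    simp only [h1]
    rw [intervalIntegral.integral_smul_const, h0 k (Finset.mem_range.1 hk), zero_smul]

end Asymptotics

/-! ### Local error of the stages -/

section StageError

variable {V : Type*} [NormedAddCommGroup V] [NormedSpace ℝ V]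

/-- The residual of the exact solution in the stage equation, divided by `h²`; here
`g(s) = q''(t₀ + s)`. -/
noncomputable def stageResidual (A : ℝ → ℝ → ℝ) (g : ℝ → V) (h τ : ℝ) : V :=
  ∫ σ in (0 : ℝ)..1, defect A τ σ • g (h * σ)

variable {A : ℝ → ℝ → ℝ} {g : ℝ → V}

lemma continuous_integral_kernel_smul {K : ℝ → ℝ → ℝ} (hK : Continuous (Function.uncurry K))
    {φ : ℝ → V} (hφ : Continuous φ) :
    Continuous fun τ => ∫ σ in (0 : ℝ)..1, K τ σ • φ σ :=
  intervalIntegral.continuous_parametric_intervalIntegral_of_continuous'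
    (hK.smul (hφ.comp continuous_snd)) 0 1

lemma continuous_stageResidual (hA : Continuous (Function.uncurry A)) (hg : Continuous g) (h : ℝ) :
    Continuous (stageResidual A g h) :=
  continuous_integral_kernel_smul (continuous_defect hA) (hg.comp (by fun_prop))

lemma stageResidual_expansion [CompleteSpace V] (hA : Continuous (Function.uncurry A))
    (hg : Continuous g) {n : ℕ}
    (hge : HasExpansion g n) :
    ∃ c : ℕ → V, IsUniformO (fun h τ => stageResidual A g h τ
      - ∑ l ∈ Finset.range n, h ^ l • defectMoment A l τ • c l) n := by
  obtain ⟨c, hc⟩ := hge.isUniformO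
  refine ⟨c, (hc.integral_kernel (continuous_defect hA)).congr (.of_forall fun h τ _ => ?_)⟩
  have hD : Continuous fun σ => defect A τ σ :=
    (continuous_defect hA).comp (by fun_prop : Continuous fun σ : ℝ => (τ, σ))
  simp only [smul_sub, Finset.smul_sum]
  rw [intervalIntegral.integral_sub (Continuous.intervalIntegrable (by fun_prop) _ _)
    (Continuous.intervalIntegrable (by fun_prop) _ _), intervalIntegral.integral_finsetSum
    fun k _ => Continuous.intervalIntegrable (by fun_prop) _ _]
  congr 1
  refine Finset.sum_congr rfl fun l _ => ?_
  have h1 : ∀ σ : ℝ, defect A τ σ • (h * σ) ^ l • c l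
      = (defect A τ σ * σ ^ l) • h ^ l • c l := fun σ => by
    rw [smul_smul, smul_smul, mul_pow]
    congr 1
    ring
  simp only [h1]
  rw [intervalIntegral.integral_smul_const, smul_comm, defectMoment]

lemma isUniformO_stageResidual_one [CompleteSpace V]
    (hA : Continuous (Function.uncurry A)) (hg : Continuous g)
    (hge : HasExpansion g 1) (h0 : ∀ τ ∈ Icc (0 : ℝ) 1, defectMoment A 0 τ = 0) :
    IsUniformO (stageResidual A g) 1 := by
  obtain ⟨c, hc⟩ := stageResidual_expansion hA hg hge
  exact hc.congr (.of_forall fun h τ hτ => by simp [h0 τ hτ])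

/-- If the moments `∫∫ u(τ) τ^a D(τ, σ) σ^b` vanish for `a + b < n`, then the residual, propagated
by a smooth operator-valued function, contributes `O(h^n)` to the integral with weight `u`. -/
lemma isUniformO_integral_stageResidual [CompleteSpace V] (hA : Continuous (Function.uncurry A))
    (hg : Continuous g) (hge : ∀ n, HasExpansion g n) {J : ℝ → V →L[ℝ] V} (hJ : Continuous J)
    (hJe : ∀ n, HasExpansion J n) {u : ℝ → ℝ} (hu : Continuous u) {n : ℕ}
    (h0 : ∀ a b, a + b < n → ∫ τ in (0 : ℝ)..1, u τ * defectMoment A b τ * τ ^ a = 0) :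
    IsUniformO (fun h _ => ∫ τ in (0 : ℝ)..1, u τ • J (h * τ) (stageResidual A g h τ)) n := by
  obtain ⟨c, hc⟩ := stageResidual_expansion hA hg (hge n)
  have hcm := continuous_defectMoment hA
  have hcr := continuous_stageResidual hA hg
  have hJR := ((isUniformO_zero_of_continuous hJ).clm_apply hc).mono (Nat.zero_add n).ge
  refine IsUniformO.integral_of_sub
    (ψ := fun h τ => ∑ l ∈ Finset.range n, h ^ l • defectMoment A l τ • J (h * τ) (c l)) hu
    (fun h => by fun_prop) (fun h => by fun_prop)
    (hJR.congr (.of_forall fun h τ _ => by simp)) ?_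
  have hl : ∀ l ∈ Finset.range n, IsUniformO (fun h _ =>
      h ^ l • ∫ τ in (0 : ℝ)..1, (u τ * defectMoment A l τ) • J (h * τ) (c l)) n := by
    intro l hl
    have hln := Finset.mem_range.1 hl
    refine (IsUniformO.pow_smul (HasExpansion.isUniformO_integral (n := n - l)
      (G := fun s => J s (c l)) ((hJe _).clm_apply_const _) (by fun_prop) (by fun_prop)
      fun k hk => h0 k l (by omega)) l).mono (by omega)
  refine (isUniformO_sum _ hl).congr (.of_forall fun h _ _ => ?_)
  simp only [Finset.smul_sum]
  rw [intervalIntegral.integral_finsetSum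
    fun k _ => Continuous.intervalIntegrable (by fun_prop) _ _]
  refine Finset.sum_congr rfl fun l _ => ?_
  rw [← intervalIntegral.integral_smul]
  congr 1 with τ
  rw [smul_comm (u τ), mul_smul]

/-- The situation in the limit `h → 0`: `E(h, τ)` is the error of the stages, `Δ(h, τ)` the
resulting error of the values of the right-hand side `f`, and `J(s)` the derivative of `f` in its
second argument along the exact solution at time `t₀ + s`, where `g(s) = q''(t₀ + s)`. -/
structure StageError (A : ℝ → ℝ → ℝ) (g : ℝ → V) (J : ℝ → V →L[ℝ] V) (E Δ : ℝ → ℝ → V) :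
    Prop where
  continuous_kernel : Continuous (Function.uncurry A)
  continuous_g : Continuous g
  expansion_g : ∀ n, HasExpansion g n
  continuous_J : Continuous J
  expansion_J : ∀ n, HasExpansion J n
  continuous_E : ∀ h, Continuous (E h)
  continuous_Δ : ∀ h, Continuous (Δ h)
  isUniformO_E : IsUniformO E 2
  linearization : ∃ C : ℝ, ∀ᶠ h in 𝓝 (0 : ℝ), ∀ τ ∈ Icc (0 : ℝ) 1,
    ‖Δ h τ - J (h * τ) (E h τ)‖ ≤ C * ‖E h τ‖ ^ 2
  stage : ∀ᶠ h in 𝓝 (0 : ℝ), ∀ τ ∈ Icc (0 : ℝ) 1,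
    E h τ = h ^ 2 • stageResidual A g h τ + h ^ 2 • ∫ σ in (0 : ℝ)..1, A τ σ • Δ h σ

namespace StageError

variable {J : ℝ → V →L[ℝ] V} {E Δ : ℝ → ℝ → V}

lemma isUniformO_linearization (S : StageError A g J E Δ) {m : ℕ} (hE : IsUniformO E m) :
    IsUniformO (fun h τ => Δ h τ - J (h * τ) (E h τ)) (2 * m) := by
  obtain ⟨C, hC⟩ := S.linearization
  obtain ⟨C', hC'⟩ := hE
  refine ⟨max C 0 * C' ^ 2, ?_⟩
  filter_upwards [hC, hC'] with h h1 h2 τ hτ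
  calc _ ≤ C * ‖E h τ‖ ^ 2 := h1 τ hτ
    _ ≤ max C 0 * (C' * |h| ^ m) ^ 2 := by
        gcongr
        · exact le_max_left _ _
        · exact h2 τ hτ
    _ = _ := by ring

lemma isUniformO_J (S : StageError A g J E Δ) : IsUniformO (fun h τ => J (h * τ)) 0 :=
  isUniformO_zero_of_continuous S.continuous_J

lemma isUniformO_Δ (S : StageError A g J E Δ) {m : ℕ} (hE : IsUniformO E m) :
    IsUniformO Δ m :=
  ((S.isUniformO_linearization hE).mono (by omega)).of_sub
    ((S.isUniformO_J.clm_apply hE).mono (Nat.zero_add m).ge)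

lemma isUniformO_E_sub (S : StageError A g J E Δ) {m : ℕ} (hE : IsUniformO E m) :
    IsUniformO (fun h τ => E h τ - h ^ 2 • stageResidual A g h τ) (2 + m) := by
  refine (((S.isUniformO_Δ hE).integral_kernel S.continuous_kernel).pow_smul 2).congr ?_
  filter_upwards [S.stage] with h hh τ hτ
  rw [hh τ hτ]
  abel

lemma continuous_J_apply (S : StageError A g J E Δ) {φ : ℝ → V} (hφ : Continuous φ) (h : ℝ) :
    Continuous fun τ => J (h * τ) (φ τ) := by
  have := S.continuous_J
  fun_prop

/-- The weighted error of `f`: after linearization, only the residual of the exact solution matters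
up to `O(h^(2m))` and `O(h^(2+m))`, and its contribution is governed by the moments of the
defect. -/
lemma isUniformO_integral_Δ [CompleteSpace V] (S : StageError A g J E Δ)
    {m k n : ℕ} (hE : IsUniformO E m)
    {u : ℝ → ℝ} (hu : Continuous u)
    (h0 : ∀ a b, a + b < n → ∫ τ in (0 : ℝ)..1, u τ * defectMoment A b τ * τ ^ a = 0)
    (h1 : k ≤ 2 * m) (h2 : k ≤ 2 + m) (h3 : k ≤ 2 + n) :
    IsUniformO (fun h _ => ∫ τ in (0 : ℝ)..1, u τ • Δ h τ) k := by
  have hcr := continuous_stageResidual S.continuous_kernel S.continuous_g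
  -- replace `Δ` by `J E`, and then `E` by `h²` times the residual
  refine IsUniformO.integral_of_sub hu S.continuous_Δ
    (fun h => S.continuous_J_apply (S.continuous_E h) h)
    ((S.isUniformO_linearization hE).mono h1) ?_
  refine IsUniformO.integral_of_sub (ψ := fun h τ => h ^ 2 • J (h * τ) (stageResidual A g h τ)) hu
    (fun h => S.continuous_J_apply (S.continuous_E h) h)
    (fun h => (S.continuous_J_apply (hcr h) h).const_smul _) ?_ ?_
  · exact ((S.isUniformO_J.clm_apply (S.isUniformO_E_sub hE)).mono (by omega)).congr
      (.of_forall fun h τ _ => by simp)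
  · refine (((isUniformO_integral_stageResidual S.continuous_kernel S.continuous_g S.expansion_g
      S.continuous_J S.expansion_J hu h0).pow_smul 2).mono h3).congr
      (.of_forall fun h τ _ => ?_)
    rw [← intervalIntegral.integral_smul]
    congr 1 with τ
    rw [smul_comm]

lemma integral_integral_kernel_smul [CompleteSpace V] {K : ℝ → ℝ → ℝ}
    (hK : Continuous (Function.uncurry K))
    {φ : ℝ → V} (hφ : Continuous φ) :
    ∫ τ in (0 : ℝ)..1, ∫ σ in (0 : ℝ)..1, K τ σ • φ σ
      = ∫ σ in (0 : ℝ)..1, (∫ τ in (0 : ℝ)..1, K τ σ) • φ σ := by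
  rw [intervalIntegral_intervalIntegral_swap]
  · congr 1 with σ
    rw [intervalIntegral.integral_smul_const]
  · have hc : Continuous (Function.uncurry fun τ σ => K τ σ • φ σ) :=
      hK.smul (hφ.comp continuous_snd)
    exact (hc.continuousOn.integrableOn_compact
      (isCompact_uIcc.prod isCompact_uIcc)).mono_set
      (prod_mono uIoc_subset_uIcc uIoc_subset_uIcc)

/-- If the row integrals of the defect vanish, the stages are accurate to third order. -/
lemma isUniformO_E_three [CompleteSpace V] (S : StageError A g J E Δ)
    (h0 : ∀ τ ∈ Icc (0 : ℝ) 1, defectMoment A 0 τ = 0) : IsUniformO E 3 :=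
  ((S.isUniformO_E_sub S.isUniformO_E).mono (by norm_num)).of_sub
    ((isUniformO_stageResidual_one S.continuous_kernel S.continuous_g (S.expansion_g 1)
      h0).pow_smul 2)

/-- The velocity error of the sixth order method. Beyond `isUniformO_integral_Δ`, the term
`∫ J(hτ) ∫ A(τ, σ) Δ(σ)` matters; it is reduced to the orthogonality of the column integrals of `A`
to the first partial moment of the defect. -/
lemma isUniformO_integral_Δ_six [CompleteSpace V] (S : StageError A g J E Δ)
    (hs : IsSymmetricKernel A)
    (h0 : ∀ τ ∈ Icc (0 : ℝ) 1, defectMoment A 0 τ = 0) (hm : DefectMomentsVanish A 4) :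
    IsUniformO (fun h _ => ∫ τ in (0 : ℝ)..1, (1 : ℝ) • Δ h τ) 6 := by
  have hA := S.continuous_kernel
  have hJ := S.continuous_J
  have hcr := continuous_stageResidual hA S.continuous_g
  have hcE := S.continuous_E
  have hcΔ := S.continuous_Δ
  have hw : Continuous fun σ => ∫ τ in (0 : ℝ)..1, A τ σ :=
    intervalIntegral.continuous_parametric_intervalIntegral_of_continuous'
      (f := fun σ τ => A τ σ) (hA.comp continuous_swap) 0 1
  have hE := S.isUniformO_E_three h0
  have hΔ := S.isUniformO_Δ hE
  have hAΔ := hΔ.integral_kernel hA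
  have hcAΔ : ∀ h, Continuous fun τ => ∫ σ in (0 : ℝ)..1, A τ σ • Δ h σ :=
    fun h => continuous_integral_kernel_smul hA (hcΔ h)
  have hJ1 := isUniformO_sub_zero (S.expansion_J 1)
  have hJ0 : IsUniformO (fun _ _ : ℝ => J 0) 0 := ⟨‖J 0‖, .of_forall fun h τ _ => by simp⟩
  -- the column integrals do not see the residual up to `O(h²)`
  have hwr : IsUniformO (fun h _ => ∫ σ in (0 : ℝ)..1,
      (∫ τ in (0 : ℝ)..1, A τ σ) • stageResidual A g h σ) 2 := by
    refine isUniformO_integral_stageResidual hA S.continuous_g S.expansion_g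
      (J := fun _ => ContinuousLinearMap.id ℝ V) continuous_const
      (hasExpansion_const _) hw fun a b hab => ?_
    rcases b with _ | b
    · refine (intervalIntegral.integral_congr fun τ hτ => ?_).trans intervalIntegral.integral_zero
      rw [uIcc_of_le zero_le_one] at hτ
      simp only [h0 τ hτ, mul_zero, zero_mul]
    · obtain ⟨rfl, rfl⟩ : a = 0 ∧ b = 0 := by omega
      simp only [pow_zero, mul_one]
      exact integral_column_mul_defectMoment_one hA hs h0 hm
  have hwE : IsUniformO (fun h _ => ∫ σ in (0 : ℝ)..1, (∫ τ in (0 : ℝ)..1, A τ σ) • E h σ) 4 := by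
    refine IsUniformO.integral_of_sub (ψ := fun h τ => h ^ 2 • stageResidual A g h τ) hw hcE
      (fun h => (hcr h).const_smul (h ^ 2))
      ((S.isUniformO_E_sub hE).mono (by norm_num)) ?_
    refine (hwr.pow_smul 2).congr (.of_forall fun h τ _ => ?_)
    rw [← intervalIntegral.integral_smul]
    congr 1 with τ
    rw [smul_comm]
  have hwΔ : IsUniformO (fun h _ => ∫ σ in (0 : ℝ)..1, (∫ τ in (0 : ℝ)..1, A τ σ) • Δ h σ) 4 := by
    refine IsUniformO.integral_of_sub (ψ := fun h τ => J 0 (E h τ)) hw hcΔ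
      (fun h => by fun_prop) ?_ ?_
    · refine (((S.isUniformO_linearization hE).mono (by norm_num)).add
        (hJ1.clm_apply hE)).congr (.of_forall fun h τ _ => ?_)
      simp
    · refine ((hJ0.clm_apply hwE).mono (by norm_num)).congr (.of_forall fun h τ _ => ?_)
      rw [← ContinuousLinearMap.intervalIntegral_comp_comm _
        (Continuous.intervalIntegrable (by fun_prop) _ _)]
      simp
  -- by Fubini, `∫∫ A Δ` is the integral of `Δ` against the column integrals
  have hJAΔ : IsUniformO (fun h _ => ∫ τ in (0 : ℝ)..1,
      (1 : ℝ) • J (h * τ) (∫ σ in (0 : ℝ)..1, A τ σ • Δ h σ)) 4 := by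
    refine IsUniformO.integral_of_sub (u := fun _ => 1)
      (ψ := fun h τ => J 0 (∫ σ in (0 : ℝ)..1, A τ σ • Δ h σ)) continuous_const
      (fun h => S.continuous_J_apply (hcAΔ h) h) (fun h => (J 0).continuous.comp (hcAΔ h))
      ((hJ1.clm_apply hAΔ).congr (.of_forall fun h τ _ => by simp)) ?_
    refine ((hJ0.clm_apply hwΔ).mono (by norm_num)).congr (.of_forall fun h τ _ => ?_)
    simp only [one_smul]
    rw [ContinuousLinearMap.intervalIntegral_comp_comm _ ((hcAΔ h).intervalIntegrable _ _),
      integral_integral_kernel_smul hA (hcΔ h)]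
  refine IsUniformO.integral_of_sub (u := fun _ => 1) continuous_const hcΔ
    (fun h => S.continuous_J_apply (hcE h) h) (S.isUniformO_linearization hE) ?_
  have h1 : IsUniformO (fun h _ => ∫ τ in (0 : ℝ)..1,
      (1 : ℝ) • J (h * τ) (stageResidual A g h τ)) 4 :=
    isUniformO_integral_stageResidual hA S.continuous_g S.expansion_g hJ S.expansion_J
      (u := fun _ => 1) continuous_const fun a b hab => by
        simpa only [one_mul, mul_comm (_ ^ a)] using hm a b hab
  refine ((h1.pow_smul 2).add (hJAΔ.pow_smul 2)).congr ?_
  filter_upwards [S.stage] with h hh τ _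
  have i1 : IntervalIntegrable (fun τ => h ^ 2 • J (h * τ) (stageResidual A g h τ)) volume 0 1 :=
    ((S.continuous_J_apply (hcr h) h).const_smul (h ^ 2)).intervalIntegrable _ _
  have i2 : IntervalIntegrable
      (fun τ => h ^ 2 • J (h * τ) (∫ σ in (0 : ℝ)..1, A τ σ • Δ h σ)) volume 0 1 :=
    ((S.continuous_J_apply (hcAΔ h) h).const_smul (h ^ 2)).intervalIntegrable _ _
  simp only [one_smul]
  rw [← intervalIntegral.integral_smul, ← intervalIntegral.integral_smul,
    ← intervalIntegral.integral_add i1 i2]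
  refine intervalIntegral.integral_congr fun τ hτ => ?_
  rw [uIcc_of_le zero_le_one] at hτ
  simp only [hh τ hτ, map_add, map_smul]

end StageError

end StageError

/-! ### Smooth problems and their solutions -/

lemma hasExpansion_of_contDiffAt {V : Type*} [NormedAddCommGroup V] [NormedSpace ℝ V] {G : ℝ → V}
    {n : ℕ} (hG : ContDiffAt ℝ n G 0) : HasExpansion G n := by
  obtain ⟨u, hu, -, hGu⟩ := ContDiffWithinAt.contDiffOn (m := n) le_rfl (by simp) hG
  simp only [mem_univ, insert_eq_of_mem, nhdsWithin_univ] at hu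
  obtain ⟨δ, hδ, hball⟩ := Metric.mem_nhds_iff.1 hu
  have h0 : (0 : ℝ) ∈ Metric.ball (0 : ℝ) δ := Metric.mem_ball_self hδ
  have h := (taylor_isLittleO (convex_ball (0 : ℝ) δ) h0 (hGu.mono hball)).isBigO
  rw [Metric.isOpen_ball.nhdsWithin_eq h0] at h
  obtain ⟨C, hC⟩ := h.bound
  set c : ℕ → V := fun k =>
    (k.factorial : ℝ)⁻¹ • iteratedDerivWithin k G (Metric.ball (0 : ℝ) δ) 0 with hc
  refine ⟨c, C + ‖c n‖, hC.mono fun s hs => ?_⟩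
  have h1 : taylorWithinEval G n (Metric.ball (0 : ℝ) δ) 0 s
      = ∑ k ∈ Finset.range n, s ^ k • c k + s ^ n • c n := by
    rw [taylor_within_apply, Finset.sum_range_succ]
    simp only [hc, sub_zero, smul_smul, mul_comm]
  rw [h1, sub_zero, norm_pow, Real.norm_eq_abs] at hs
  calc ‖G s - ∑ k ∈ Finset.range n, s ^ k • c k‖
      = ‖(G s - (∑ k ∈ Finset.range n, s ^ k • c k + s ^ n • c n)) + s ^ n • c n‖ := by
        congr 1; abel
    _ ≤ C * |s| ^ n + |s| ^ n * ‖c n‖ := by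
        refine (norm_add_le _ _).trans (add_le_add hs ?_)
        rw [norm_smul, norm_pow, Real.norm_eq_abs]
    _ = (C + ‖c n‖) * |s| ^ n := by ring

/-- A `C^1` function is Lipschitz on compact convex sets. -/
lemma exists_lipschitz_bound_of_contDiff {X Y : Type*} [NormedAddCommGroup X] [NormedSpace ℝ X]
    [NormedAddCommGroup Y] [NormedSpace ℝ Y] {F : X → Y} (hF : ContDiff ℝ 1 F) {s : Set X}
    (hs : IsCompact s) (hc : Convex ℝ s) :
    ∃ L : ℝ, 0 ≤ L ∧ ∀ x ∈ s, ∀ y ∈ s, ‖F x - F y‖ ≤ L * ‖x - y‖ := by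
  obtain ⟨L, hL⟩ := hs.exists_bound_of_continuousOn
    (hF.continuous_fderiv one_ne_zero).continuousOn
  refine ⟨max L 0, le_max_right _ _, fun x hx y hy => ?_⟩
  exact hc.norm_image_sub_le_of_norm_fderiv_le
    (fun z _ => (hF.differentiable one_ne_zero).differentiableAt)
    (fun z hz => (hL z hz).trans (le_max_left _ _)) hy hx

section Problem

variable {d : ℕ} {f : ℝ → Vec d → Vec d}

/-- The derivative of `f(t, ·)` at `x`. -/
noncomputable def spaceDeriv (f : ℝ → Vec d → Vec d) (t : ℝ) (x : Vec d) : Vec d →L[ℝ] Vec d :=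
  (fderiv ℝ (Function.uncurry f) (t, x)).comp (ContinuousLinearMap.inr ℝ ℝ (Vec d))

lemma contDiff_spaceDeriv (hf : ContDiff ℝ ∞ (Function.uncurry f)) :
    ContDiff ℝ ∞ (Function.uncurry (spaceDeriv f)) := by
  have h : ContDiff ℝ ∞ (fderiv ℝ (Function.uncurry f)) := hf.fderiv_right (by simp)
  exact h.clm_comp contDiff_const

lemma hasFDerivAt_spaceDeriv (hf : ContDiff ℝ ∞ (Function.uncurry f)) (t : ℝ) (x : Vec d) :
    HasFDerivAt (f t) (spaceDeriv f t x) x :=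
  HasFDerivAt.comp x (f := fun x => (t, x)) ((hf.differentiable (by simp)) (t, x)).hasFDerivAt
    (hasFDerivAt_prodMk_right t x)

lemma convex_problem_region (t₀ : ℝ) (q₀ : Vec d) (r : ℝ) :
    Convex ℝ (Icc (t₀ - 1) (t₀ + 1) ×ˢ Metric.closedBall q₀ r) :=
  (convex_Icc _ _).prod (convex_closedBall _ _)

lemma isCompact_problem_region (t₀ : ℝ) (q₀ : Vec d) (r : ℝ) :
    IsCompact (Icc (t₀ - 1) (t₀ + 1) ×ˢ Metric.closedBall q₀ r) :=
  isCompact_Icc.prod (isCompact_closedBall _ _)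

lemma exists_lipschitz_problem {Y : Type*} [NormedAddCommGroup Y] [NormedSpace ℝ Y]
    {F : ℝ → Vec d → Y} (hF : ContDiff ℝ ∞ (Function.uncurry F))
    (t₀ : ℝ) (q₀ : Vec d) (r : ℝ) :
    ∃ L : ℝ, 0 ≤ L ∧ ∀ t ∈ Icc (t₀ - 1) (t₀ + 1), ∀ x ∈ Metric.closedBall q₀ r,
      ∀ y ∈ Metric.closedBall q₀ r, ‖F t x - F t y‖ ≤ L * ‖x - y‖ := by
  obtain ⟨L, hL0, hL⟩ := exists_lipschitz_bound_of_contDiff (hF.of_le (by simp))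
    (isCompact_problem_region t₀ q₀ r) (convex_problem_region t₀ q₀ r)
  refine ⟨L, hL0, fun t ht x hx y hy => ?_⟩
  simpa [Prod.norm_def] using hL (t, x) ⟨ht, hx⟩ (t, y) ⟨ht, hy⟩

lemma exists_linearization_problem (hf : ContDiff ℝ ∞ (Function.uncurry f))
    (t₀ : ℝ) (q₀ : Vec d) (r : ℝ) :
    ∃ C : ℝ, ∀ t ∈ Icc (t₀ - 1) (t₀ + 1), ∀ x ∈ Metric.closedBall q₀ r,
      ∀ y ∈ Metric.closedBall q₀ r,
        ‖f t x - f t y - spaceDeriv f t x (x - y)‖ ≤ C * ‖x - y‖ ^ 2 := by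
  obtain ⟨L, hL0, hL⟩ := exists_lipschitz_problem (contDiff_spaceDeriv hf) t₀ q₀ r
  refine ⟨L, fun t ht x hx y hy => ?_⟩
  have hseg : segment ℝ x y ⊆ Metric.closedBall q₀ r := (convex_closedBall _ _).segment_subset hx hy
  have h := (convex_segment x y).norm_image_sub_le_of_norm_hasFDerivWithin_le'
    (f := f t) (f' := spaceDeriv f t) (φ := spaceDeriv f t x) (C := L * ‖x - y‖)
    (fun z _ => (hasFDerivAt_spaceDeriv hf t z).hasFDerivWithinAt)
    (fun z hz => (hL t ht z (hseg hz) x hx).trans ?_)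
    (right_mem_segment ℝ x y) (left_mem_segment ℝ x y)
  · rw [pow_two, ← mul_assoc]
    exact h
  · rw [norm_sub_rev x y]
    exact mul_le_mul_of_nonneg_left (norm_sub_le_of_mem_segment hz) hL0

variable {t₀ : ℝ} {q₀ v₀ : Vec d} {q v : ℝ → Vec d}

lemma IsLocalSolution.contDiffAt (hf : ContDiff ℝ ∞ (Function.uncurry f))
    (hq : IsLocalSolution f t₀ q₀ v₀ q v) (n : ℕ) : ContDiffAt ℝ n q t₀ := by
  obtain ⟨δ, hδ, hball⟩ := Metric.eventually_nhds_iff_ball.1 hq.hasDerivAt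
  have hmain : ∀ n : ℕ, ContDiffOn ℝ n q (Metric.ball t₀ δ) ∧
      ContDiffOn ℝ n v (Metric.ball t₀ δ) := by
    intro n
    induction n with
    | zero =>
      simp only [Nat.cast_zero, contDiffOn_zero]
      exact ⟨fun t ht => (hball t ht).1.continuousAt.continuousWithinAt,
        fun t ht => (hball t ht).2.continuousAt.continuousWithinAt⟩
    | succ n ih =>
      push_cast
      rw [contDiffOn_succ_iff_deriv_of_isOpen Metric.isOpen_ball,
        contDiffOn_succ_iff_deriv_of_isOpen Metric.isOpen_ball]
      refine ⟨⟨fun t ht => (hball t ht).1.differentiableAt.differentiableWithinAt, by simp,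
        ih.2.congr fun t ht => (hball t ht).1.deriv⟩,
        ⟨fun t ht => (hball t ht).2.differentiableAt.differentiableWithinAt, by simp,
        ContDiffOn.congr (f := fun t => f t (q t)) ?_ fun t ht => (hball t ht).2.deriv⟩⟩
      exact (hf.of_le (by exact_mod_cast le_top)).comp_contDiffOn (contDiffOn_id.prodMk ih.1)
  exact (hmain n).1.contDiffAt (Metric.ball_mem_nhds _ hδ)

/-- A local solution can be modified away from `t₀` so as to be continuous everywhere. -/
lemma IsLocalSolution.exists_continuous_extension (hq : IsLocalSolution f t₀ q₀ v₀ q v) :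
    ∃ q' : ℝ → Vec d, Continuous q' ∧ q' =ᶠ[𝓝 t₀] q := by
  obtain ⟨δ, hδ, hball⟩ := Metric.eventually_nhds_iff_ball.1 hq.hasDerivAt
  have hle : t₀ - δ / 2 ≤ t₀ + δ / 2 := by linarith
  have hc : ContinuousOn q (Icc (t₀ - δ / 2) (t₀ + δ / 2)) := fun t ht => by
    refine (hball t ?_).1.continuousAt.continuousWithinAt
    rw [Metric.mem_ball, Real.dist_eq, abs_lt]
    constructor <;> linarith [ht.1, ht.2]
  refine ⟨IccExtend hle ((Icc (t₀ - δ / 2) (t₀ + δ / 2)).domRestrict q),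
    (continuousOn_iff_continuous_domRestrict.1 hc).Icc_extend', ?_⟩
  filter_upwards [Icc_mem_nhds (show t₀ - δ / 2 < t₀ by linarith)
    (show t₀ < t₀ + δ / 2 by linarith)] with t ht
  rw [IccExtend_of_mem _ _ ht, domRestrict_apply]

lemma IsLocalSolution.congr {q' : ℝ → Vec d} (hq : IsLocalSolution f t₀ q₀ v₀ q v)
    (h : q' =ᶠ[𝓝 t₀] q) : IsLocalSolution f t₀ q₀ v₀ q' v := by
  refine ⟨?_, h.self_of_nhds.trans hq.init_position, hq.init_velocity⟩
  filter_upwards [hq.hasDerivAt, h.eventually_nhds] with t ht h'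
  refine ⟨ht.1.congr_of_eventuallyEq h', ?_⟩
  rw [h'.self_of_nhds]
  exact ht.2

lemma eventually_forall_unit_of_eventually {P : ℝ → Prop} (h : ∀ᶠ t in 𝓝 t₀, P t) :
    ∀ᶠ h in 𝓝 (0 : ℝ), ∀ τ ∈ Icc (0 : ℝ) 1, P (t₀ + h * τ) := by
  obtain ⟨δ, hδ, hball⟩ := Metric.eventually_nhds_iff_ball.1 h
  filter_upwards [Metric.ball_mem_nhds (0 : ℝ) hδ] with h hh τ hτ
  refine hball _ ?_
  rw [mem_ball_zero_iff, Real.norm_eq_abs] at hh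
  rw [Metric.mem_ball, Real.dist_eq, add_sub_cancel_left, abs_mul, abs_of_nonneg hτ.1]
  exact (mul_le_of_le_one_right (abs_nonneg _) hτ.2).trans_lt hh

lemma IsLocalSolution.velocity_eq (hf : ContDiff ℝ ∞ (Function.uncurry f))
    (hq : IsLocalSolution f t₀ q₀ v₀ q v) (hqc : Continuous q) :
    ∀ᶠ h in 𝓝 (0 : ℝ), v (t₀ + h) =
      v₀ + h • ∫ σ in (0 : ℝ)..1, f (t₀ + h * σ) (q (t₀ + h * σ)) := by
  filter_upwards [eventually_forall_unit_of_eventually hq.hasDerivAt] with h hh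
  have hc : Continuous fun σ => f (t₀ + h * σ) (q (t₀ + h * σ)) :=
    hf.continuous.comp (by fun_prop : Continuous fun σ => (t₀ + h * σ, q (t₀ + h * σ)))
  rw [← intervalIntegral.integral_smul, intervalIntegral.integral_eq_sub_of_hasDerivAt
    (f := fun σ => v (t₀ + h * σ)) (fun σ hσ => ?_)
    (Continuous.intervalIntegrable (by fun_prop) _ _)]
  · simp [hq.init_velocity]
  · rw [uIcc_of_le zero_le_one] at hσ
    have h1 : HasDerivAt (fun σ => t₀ + h * σ) h σ := by
      simpa using ((hasDerivAt_id σ).const_mul h).const_add t₀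
    exact (hh σ hσ).2.scomp σ h1

/-- The exact solution satisfies the stage equation with the kernel `(τ - σ)₊`. -/
lemma IsLocalSolution.position_eq (hf : ContDiff ℝ ∞ (Function.uncurry f))
    (hq : IsLocalSolution f t₀ q₀ v₀ q v) (hqc : Continuous q) :
    ∀ᶠ h in 𝓝 (0 : ℝ), ∀ τ ∈ Icc (0 : ℝ) 1, q (t₀ + h * τ) = q₀ + (h * τ) • v₀
      + h ^ 2 • ∫ σ in (0 : ℝ)..1, exactKernel τ σ • f (t₀ + h * σ) (q (t₀ + h * σ)) := by
  filter_upwards [eventually_forall_unit_of_eventually hq.hasDerivAt] with h hh τ hτ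
  have hc : Continuous fun σ => f (t₀ + h * σ) (q (t₀ + h * σ)) :=
    hf.continuous.comp (by fun_prop : Continuous fun σ => (t₀ + h * σ, q (t₀ + h * σ)))
  rw [integral_exactKernel_smul hc.continuousOn hτ, ← intervalIntegral.integral_smul,
    intervalIntegral.integral_eq_sub_of_hasDerivAt
    (f := fun σ => ((τ - σ) * h) • v (t₀ + h * σ) + q (t₀ + h * σ)) (fun σ hσ => ?_)
    (Continuous.intervalIntegrable (by fun_prop) _ _)]
  · simp only [sub_self, zero_mul, zero_smul, sub_zero, mul_zero, add_zero, zero_add,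
      hq.init_velocity, hq.init_position, mul_comm τ h]
    abel
  · rw [uIcc_of_le hτ.1] at hσ
    have hσ' : σ ∈ Icc (0 : ℝ) 1 := ⟨hσ.1, hσ.2.trans hτ.2⟩
    have h1 : HasDerivAt (fun σ => t₀ + h * σ) h σ := by
      simpa using ((hasDerivAt_id σ).const_mul h).const_add t₀
    have h2 : HasDerivAt (fun σ => (τ - σ) * h) (-h) σ := by
      simpa using ((hasDerivAt_id σ).const_sub τ).mul_const h
    refine ((h2.smul ((hh σ hσ').2.scomp σ h1)).add ((hh σ hσ').1.scomp σ h1)).congr_deriv ?_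
    simp only [Function.comp]
    module

end Problem

/-! ### Symmetry of the method -/

/-- The method with kernel `A`, `B̄_τ = 1 - τ`, `B_τ = 1` and `C_τ = τ`. -/
def kernelMethod (A : ℝ → ℝ → ℝ) : CSRKN where
  A := A
  Bbar := fun τ => 1 - τ
  B := fun _ => 1
  C := fun τ => τ

section Step

variable {d : ℕ} {f : ℝ → Vec d → Vec d} {h t₀ : ℝ} {z₀ z₁ : Vec d × Vec d} {Q : ℝ → Vec d}

lemma intervalIntegral_congr_unit {V : Type*} [NormedAddCommGroup V] [NormedSpace ℝ V]
    {φ ψ : ℝ → V} (h : ∀ x ∈ Icc (0 : ℝ) 1, φ x = ψ x) :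
    ∫ x in (0 : ℝ)..1, φ x = ∫ x in (0 : ℝ)..1, ψ x := by
  refine intervalIntegral.integral_congr fun x hx => ?_
  rw [uIcc_of_le zero_le_one] at hx
  exact h x hx

lemma IntervalIntegrable.congr_unit {V : Type*} [NormedAddCommGroup V]
    {φ ψ : ℝ → V} (hφ : IntervalIntegrable φ volume 0 1) (h : ∀ x ∈ Icc (0 : ℝ) 1, φ x = ψ x) :
    IntervalIntegrable ψ volume 0 1 := by
  refine hφ.congr fun x hx => ?_
  rw [uIoc_of_le zero_le_one] at hx
  exact h x (Ioc_subset_Icc_self hx)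

/-- Only the values of the coefficients on `[0, 1]` matter. -/
lemma CSRKN.IsStep.congr {M M' : CSRKN}
    (hA : ∀ τ ∈ Icc (0 : ℝ) 1, ∀ σ ∈ Icc (0 : ℝ) 1, M.A τ σ = M'.A τ σ)
    (hBbar : ∀ τ ∈ Icc (0 : ℝ) 1, M.Bbar τ = M'.Bbar τ)
    (hB : ∀ τ ∈ Icc (0 : ℝ) 1, M.B τ = M'.B τ) (hC : ∀ τ ∈ Icc (0 : ℝ) 1, M.C τ = M'.C τ)
    (hM : M.IsStep f h t₀ z₀ Q z₁) : M'.IsStep f h t₀ z₀ Q z₁ := by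
  have h1 : ∀ τ ∈ Icc (0 : ℝ) 1, ∀ σ ∈ Icc (0 : ℝ) 1,
      M.A τ σ • f (t₀ + M.C σ * h) (Q σ) = M'.A τ σ • f (t₀ + M'.C σ * h) (Q σ) :=
    fun τ hτ σ hσ => by rw [hA τ hτ σ hσ, hC σ hσ]
  have h2 : ∀ τ ∈ Icc (0 : ℝ) 1,
      M.Bbar τ • f (t₀ + M.C τ * h) (Q τ) = M'.Bbar τ • f (t₀ + M'.C τ * h) (Q τ) :=
    fun τ hτ => by rw [hBbar τ hτ, hC τ hτ]
  have h3 : ∀ τ ∈ Icc (0 : ℝ) 1,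
      M.B τ • f (t₀ + M.C τ * h) (Q τ) = M'.B τ • f (t₀ + M'.C τ * h) (Q τ) :=
    fun τ hτ => by rw [hB τ hτ, hC τ hτ]
  refine ⟨fun τ hτ => (hM.integrable_stage τ hτ).congr_unit (h1 τ hτ),
    hM.integrable_position.congr_unit h2, hM.integrable_velocity.congr_unit h3,
    fun τ hτ => ?_, ?_, ?_⟩
  · rw [hM.stage τ hτ, intervalIntegral_congr_unit (h1 τ hτ), hC τ hτ]
  · rw [hM.position, intervalIntegral_congr_unit h2]
  · rw [hM.velocity, intervalIntegral_congr_unit h3]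

lemma CSRKN.method_congr {M M' : CSRKN}
    (hA : ∀ τ ∈ Icc (0 : ℝ) 1, ∀ σ ∈ Icc (0 : ℝ) 1, M.A τ σ = M'.A τ σ)
    (hBbar : ∀ τ ∈ Icc (0 : ℝ) 1, M.Bbar τ = M'.Bbar τ)
    (hB : ∀ τ ∈ Icc (0 : ℝ) 1, M.B τ = M'.B τ) (hC : ∀ τ ∈ Icc (0 : ℝ) 1, M.C τ = M'.C τ)
    (f : ℝ → Vec d → Vec d) (U : Set (Vec d)) : M.method f U = M'.method f U := by
  ext h t₀ z₀ z₁
  exact ⟨fun ⟨Q, hU, hQ⟩ => ⟨Q, hU, hQ.congr hA hBbar hB hC⟩,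
    fun ⟨Q, hU, hQ⟩ => ⟨Q, hU, hQ.congr (fun τ hτ σ hσ => (hA τ hτ σ hσ).symm)
      (fun τ hτ => (hBbar τ hτ).symm) (fun τ hτ => (hB τ hτ).symm)
      fun τ hτ => (hC τ hτ).symm⟩⟩

lemma intervalIntegrable_comp_one_sub {V : Type*} [NormedAddCommGroup V] {φ : ℝ → V}
    (hφ : IntervalIntegrable φ volume 0 1) :
    IntervalIntegrable (fun x => φ (1 - x)) volume 0 1 := by
  simpa using (hφ.comp_sub_left 1).symm

/-- The stages of a step of the adjoint method, in reversed order, are the stages of a step of the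
method. -/
lemma kernelMethod_isStep_reverse {A : ℝ → ℝ → ℝ} (hs : IsSymmetricKernel A)
    (hQ : (kernelMethod A).IsStep f (-h) (t₀ + h) z₁ Q z₀) :
    (kernelMethod A).IsStep f h t₀ z₀ (fun τ => Q (1 - τ)) z₁ := by
  obtain ⟨i1, i2, i3, e1, e2, e3⟩ := hQ
  simp only [kernelMethod, one_smul] at i1 i2 i3 e1 e2 e3
  set F : ℝ → Vec d := fun σ => f (t₀ + σ * h) (Q (1 - σ)) with hF
  have hFF : ∀ σ, f (t₀ + h + (1 - σ) * -h) (Q (1 - σ)) = F σ := fun σ => by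
    simp only [hF]
    congr 1
    ring
  have j0 : IntervalIntegrable F volume 0 1 := by
    simpa only [hFF] using intervalIntegrable_comp_one_sub i3
  have j1 : IntervalIntegrable (fun σ => σ • F σ) volume 0 1 := by
    simpa only [hFF, sub_sub_cancel] using intervalIntegrable_comp_one_sub i2
  have hker : ∀ τ ∈ Icc (0 : ℝ) 1, ∀ σ ∈ Icc (0 : ℝ) 1,
      A (1 - τ) (1 - σ) • F σ = A τ σ • F σ - τ • F σ + σ • F σ := fun τ hτ σ hσ => by
    rw [hs τ hτ σ hσ, add_smul, sub_smul]
  have jA : ∀ τ ∈ Icc (0 : ℝ) 1, IntervalIntegrable (fun σ => A τ σ • F σ) volume 0 1 := by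
    intro τ hτ
    have h1 := intervalIntegrable_comp_one_sub (i1 (1 - τ) (one_sub_mem_unitInterval hτ))
    simp only [hFF] at h1
    refine ((h1.add (j0.smul τ)).sub j1).congr_unit fun σ hσ => ?_
    simp only [Pi.smul_apply, hker τ hτ σ hσ]
    abel
  have k0 : ∫ σ in (0 : ℝ)..1, f (t₀ + h + σ * -h) (Q σ) = ∫ σ in (0 : ℝ)..1, F σ := by
    rw [← integral_comp_one_sub]
    simp only [hFF]
  have k1 : ∫ σ in (0 : ℝ)..1, (1 - σ) • f (t₀ + h + σ * -h) (Q σ)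
      = ∫ σ in (0 : ℝ)..1, σ • F σ := by
    rw [← integral_comp_one_sub]
    simp only [hFF, sub_sub_cancel]
  have kA : ∀ τ ∈ Icc (0 : ℝ) 1,
      ∫ σ in (0 : ℝ)..1, A (1 - τ) σ • f (t₀ + h + σ * -h) (Q σ)
        = (∫ σ in (0 : ℝ)..1, A τ σ • F σ) - τ • (∫ σ in (0 : ℝ)..1, F σ)
          + ∫ σ in (0 : ℝ)..1, σ • F σ := by
    intro τ hτ
    have jτ : IntervalIntegrable (fun σ => τ • F σ) volume 0 1 := j0.smul τ
    rw [← integral_comp_one_sub, ← intervalIntegral.integral_smul,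
      ← intervalIntegral.integral_sub (jA τ hτ) jτ,
      ← intervalIntegral.integral_add ((jA τ hτ).sub jτ) j1]
    refine intervalIntegral_congr_unit fun σ hσ => ?_
    rw [hFF]
    exact hker τ hτ σ hσ
  have kB : ∫ σ in (0 : ℝ)..1, (1 - σ) • F σ
      = (∫ σ in (0 : ℝ)..1, F σ) - ∫ σ in (0 : ℝ)..1, σ • F σ := by
    rw [← intervalIntegral.integral_sub j0 j1]
    simp only [sub_smul, one_smul]
  rw [k0] at e3
  rw [k1] at e2
  refine ⟨jA, ?_, ?_, fun τ hτ => ?_, ?_, ?_⟩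
  · simp only [kernelMethod, sub_smul, one_smul]
    exact j0.sub j1
  · simpa only [kernelMethod, one_smul] using j0
  · have := e1 (1 - τ) (one_sub_mem_unitInterval hτ)
    rw [kA τ hτ] at this
    simp only [kernelMethod]
    rw [this, e2, e3]
    module
  · simp only [kernelMethod]
    rw [kB, e2, e3]
    module
  · simp only [kernelMethod, one_smul]
    rw [e3]
    module

lemma isSymmetric_kernelMethod {A : ℝ → ℝ → ℝ} (hs : IsSymmetricKernel A) :
    (kernelMethod A).IsSymmetric := by
  intro d f _ U
  have key : ∀ h t₀ z₀ z₁, (kernelMethod A).method f U (-h) (t₀ + h) z₁ z₀ →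
      (kernelMethod A).method f U h t₀ z₀ z₁ := fun h t₀ z₀ z₁ ⟨Q, hU, hQ⟩ =>
    ⟨fun τ => Q (1 - τ), fun τ hτ => hU _ (one_sub_mem_unitInterval hτ),
      kernelMethod_isStep_reverse hs hQ⟩
  ext h t₀ z₀ z₁
  refine ⟨key h t₀ z₀ z₁, fun hz => key (-h) (t₀ + h) z₁ z₀ ?_⟩
  simpa using hz

end Step

/-! ### Solvability of the stage equation -/

section Solvability

variable {A : ℝ → ℝ → ℝ} {d : ℕ} {f : ℝ → Vec d → Vec d}

lemma exists_kernel_bound (hA : Continuous (Function.uncurry A)) :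
    ∃ B : ℝ, 0 ≤ B ∧ ∀ τ ∈ Icc (0 : ℝ) 1, ∀ σ ∈ Icc (0 : ℝ) 1, ‖A τ σ‖ ≤ B := by
  obtain ⟨B, hB⟩ := (isCompact_Icc.prod isCompact_Icc).exists_bound_of_continuousOn
    (s := Icc (0 : ℝ) 1 ×ˢ Icc (0 : ℝ) 1) hA.continuousOn
  exact ⟨max B 0, le_max_right _ _, fun τ hτ σ hσ => (hB (τ, σ) ⟨hτ, hσ⟩).trans (le_max_left _ _)⟩

lemma eventually_abs_mul_le (c : ℝ) {ε : ℝ} (hε : 0 < ε) : ∀ᶠ h in 𝓝 (0 : ℝ), |h| * c ≤ ε := by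
  have : Tendsto (fun h : ℝ => |h| * c) (𝓝 0) (𝓝 (|0| * c)) :=
    (continuous_abs.mul continuous_const).tendsto 0
  rw [abs_zero, zero_mul] at this
  exact (this.eventually (gt_mem_nhds hε)).mono fun _ h => h.le

lemma eventually_time_mem (t₀ : ℝ) :
    ∀ᶠ h in 𝓝 (0 : ℝ), ∀ τ ∈ Icc (0 : ℝ) 1, t₀ + h * τ ∈ Icc (t₀ - 1) (t₀ + 1) :=
  eventually_forall_unit_of_eventually (Icc_mem_nhds (by linarith) (by linarith))

/-- For small `h` the right-hand side of the stage equation contracts uniform distances by a factor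
`1/2` on families of stages in a fixed ball. -/
lemma eventually_stage_contraction (hA : Continuous (Function.uncurry A))
    (hf : ContDiff ℝ ∞ (Function.uncurry f)) (t₀ : ℝ) (q₀ : Vec d) (r : ℝ) :
    ∀ᶠ h in 𝓝 (0 : ℝ), ∀ Q Q' : ℝ → Vec d,
      (∀ τ ∈ Icc (0 : ℝ) 1, Q τ ∈ Metric.closedBall q₀ r) →
      (∀ τ ∈ Icc (0 : ℝ) 1, Q' τ ∈ Metric.closedBall q₀ r) →
      ∀ c : ℝ, (∀ τ ∈ Icc (0 : ℝ) 1, ‖Q τ - Q' τ‖ ≤ c) → ∀ τ ∈ Icc (0 : ℝ) 1,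
      IntervalIntegrable (fun σ => A τ σ • f (t₀ + h * σ) (Q σ)) volume 0 1 →
      IntervalIntegrable (fun σ => A τ σ • f (t₀ + h * σ) (Q' σ)) volume 0 1 →
      ‖h ^ 2 • (∫ σ in (0 : ℝ)..1, A τ σ • f (t₀ + h * σ) (Q σ))
        - h ^ 2 • ∫ σ in (0 : ℝ)..1, A τ σ • f (t₀ + h * σ) (Q' σ)‖ ≤ 1 / 2 * c := by
  obtain ⟨B, hB0, hB⟩ := exists_kernel_bound hA
  obtain ⟨L, hL0, hL⟩ := exists_lipschitz_problem hf t₀ q₀ r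
  filter_upwards [eventually_time_mem t₀, eventually_abs_mul_le 1 one_pos,
    eventually_abs_mul_le (B * L) (show (0 : ℝ) < 1 / 2 by norm_num)]
    with h ht h1 hBL Q Q' hQ hQ' c hc τ hτ i1 i2
  have hc0 : 0 ≤ c := (norm_nonneg _).trans (hc τ hτ)
  rw [mul_one] at h1
  rw [← smul_sub, ← intervalIntegral.integral_sub i1 i2, norm_smul, norm_pow, Real.norm_eq_abs]
  have hI := intervalIntegral.norm_integral_le_of_norm_le_const (a := (0 : ℝ)) (b := 1)
    (f := fun σ => A τ σ • f (t₀ + h * σ) (Q σ) - A τ σ • f (t₀ + h * σ) (Q' σ))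
    (C := B * (L * c)) fun σ hσ => by
      rw [uIoc_of_le zero_le_one] at hσ
      have hσ' := Ioc_subset_Icc_self hσ
      rw [← smul_sub, norm_smul]
      refine mul_le_mul (hB τ hτ σ hσ') ?_ (norm_nonneg _) hB0
      exact (hL _ (ht σ hσ') _ (hQ σ hσ') _ (hQ' σ hσ')).trans
        (mul_le_mul_of_nonneg_left (hc σ hσ') hL0)
  rw [sub_zero, abs_one, mul_one] at hI
  calc _ ≤ |h| ^ 2 * (B * (L * c)) := by gcongr
    _ = (|h| * (|h| * (B * L))) * c := by ring
    _ ≤ (1 * (1 / 2)) * c := by gcongr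
    _ = 1 / 2 * c := by ring

/-- For small `h` the stage equation determines the stages in a given ball. -/
lemma eventually_stage_unique (hA : Continuous (Function.uncurry A))
    (hf : ContDiff ℝ ∞ (Function.uncurry f)) (t₀ : ℝ) (q₀ v₀ : Vec d) (r : ℝ) :
    ∀ᶠ h in 𝓝 (0 : ℝ), ∀ z z',
      (kernelMethod A).method f (Metric.closedBall q₀ r) h t₀ (q₀, v₀) z →
      (kernelMethod A).method f (Metric.closedBall q₀ r) h t₀ (q₀, v₀) z' → z = z' := by
  filter_upwards [eventually_stage_contraction hA hf t₀ q₀ r]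
    with h hcontr z z' ⟨Q, hQ, hz⟩ ⟨Q', hQ', hz'⟩
  obtain ⟨i1, -, -, e1, e2, e3⟩ := hz
  obtain ⟨i1', -, -, e1', e2', e3'⟩ := hz'
  have ht : ∀ σ, t₀ + σ * h = t₀ + h * σ := fun σ => by rw [mul_comm]
  simp only [kernelMethod, one_smul, ht] at i1 i1' e1 e1' e2 e2' e3 e3'
  have hstep : ∀ n : ℕ, ∀ τ ∈ Icc (0 : ℝ) 1, ‖Q τ - Q' τ‖ ≤ (1 / 2) ^ n * (2 * r) := by
    intro n
    induction n with
    | zero =>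
      intro τ hτ
      have h1 := mem_closedBall_iff_norm.1 (hQ τ hτ)
      have h2 := mem_closedBall_iff_norm.1 (hQ' τ hτ)
      calc ‖Q τ - Q' τ‖ = ‖(Q τ - q₀) - (Q' τ - q₀)‖ := by congr 1; abel
        _ ≤ ‖Q τ - q₀‖ + ‖Q' τ - q₀‖ := norm_sub_le _ _
        _ ≤ _ := by linarith
    | succ n ih =>
      intro τ hτ
      have := hcontr Q Q' hQ hQ' _ ih τ hτ (i1 τ hτ) (i1' τ hτ)
      rw [e1 τ hτ, e1' τ hτ, add_sub_add_left_eq_sub]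
      exact this.trans_eq (by ring)
  have hQQ : ∀ τ ∈ Icc (0 : ℝ) 1, Q τ = Q' τ := by
    intro τ hτ
    have hlim : Tendsto (fun n : ℕ => (1 / 2 : ℝ) ^ n * (2 * r)) atTop (𝓝 (0 * (2 * r))) :=
      (tendsto_pow_atTop_nhds_zero_of_lt_one (by norm_num) (by norm_num)).mul_const _
    rw [zero_mul] at hlim
    have := ge_of_tendsto' hlim fun n => hstep n τ hτ
    exact sub_eq_zero.1 (norm_le_zero_iff.1 this)
  refine Prod.ext ?_ ?_
  · rw [e2, e2', intervalIntegral_congr_unit fun τ hτ => by rw [hQQ τ hτ]]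
  · rw [e3, e3', intervalIntegral_congr_unit fun τ hτ => by rw [hQQ τ hτ]]

/-- For small `h` the stage equation has a continuous solution near `q₀`, by the contraction
principle. -/
lemma eventually_stage_exists (hA : Continuous (Function.uncurry A))
    (hf : ContDiff ℝ ∞ (Function.uncurry f)) (t₀ : ℝ) (q₀ v₀ : Vec d) {r : ℝ} (hr : 0 < r) :
    ∀ᶠ h in 𝓝 (0 : ℝ), ∃ Q : ℝ → Vec d, Continuous Q ∧ ∀ τ ∈ Icc (0 : ℝ) 1,
      Q τ ∈ Metric.closedBall q₀ r ∧ Q τ = q₀ + (h * τ) • v₀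
        + h ^ 2 • ∫ σ in (0 : ℝ)..1, A τ σ • f (t₀ + h * σ) (Q σ) := by
  obtain ⟨B, hB0, hB⟩ := exists_kernel_bound hA
  obtain ⟨F, hF⟩ := (isCompact_problem_region t₀ q₀ r).exists_bound_of_continuousOn
    hf.continuous.continuousOn
  filter_upwards [eventually_stage_contraction hA hf t₀ q₀ r, eventually_time_mem t₀,
    eventually_abs_mul_le 1 one_pos, eventually_abs_mul_le (‖v₀‖ + B * F) hr]
    with h hcontr ht h1 hr'
  rw [mul_one] at h1
  -- the right-hand side of the stage equation, as a function of continuous stages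
  have hcont : ∀ Q : C(Icc (0 : ℝ) 1, Vec d), Continuous fun σ =>
      f (t₀ + h * σ) (IccExtend zero_le_one Q σ) := fun Q =>
    hf.continuous.comp ((by fun_prop : Continuous fun σ : ℝ => t₀ + h * σ).prodMk
      Q.continuous.Icc_extend')
  have hcA : ∀ Q : C(Icc (0 : ℝ) 1, Vec d), Continuous fun τ =>
      ∫ σ in (0 : ℝ)..1, A τ σ • f (t₀ + h * σ) (IccExtend zero_le_one Q σ) := fun Q =>
    continuous_integral_kernel_smul hA (hcont Q)
  have hii : ∀ (Q : C(Icc (0 : ℝ) 1, Vec d)) (τ : ℝ), IntervalIntegrable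
      (fun σ => A τ σ • f (t₀ + h * σ) (IccExtend zero_le_one Q σ)) volume 0 1 := fun Q τ =>
    ((hA.comp (by fun_prop : Continuous fun σ : ℝ => (τ, σ))).smul
      (hcont Q)).intervalIntegrable _ _
  set T : C(Icc (0 : ℝ) 1, Vec d) → C(Icc (0 : ℝ) 1, Vec d) := fun Q =>
    ⟨fun τ => q₀ + (h * (τ : ℝ)) • v₀
      + h ^ 2 • ∫ σ in (0 : ℝ)..1, A τ σ • f (t₀ + h * σ) (IccExtend zero_le_one Q σ),
      ((continuous_const.add (by fun_prop)).add
        (((hcA Q).comp continuous_subtype_val).const_smul (h ^ 2)))⟩ with hT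
  have hball : ∀ Q ∈ Metric.closedBall (ContinuousMap.const (Icc (0 : ℝ) 1) q₀) r,
      ∀ σ, IccExtend zero_le_one Q σ ∈ Metric.closedBall q₀ r := fun Q hQ σ =>
    (ContinuousMap.dist_le hr.le).1 (Metric.mem_closedBall.1 hQ) _
  have hmaps : MapsTo T (Metric.closedBall (ContinuousMap.const (Icc (0 : ℝ) 1) q₀) r)
      (Metric.closedBall (ContinuousMap.const (Icc (0 : ℝ) 1) q₀) r) := by
    intro Q hQ
    refine Metric.mem_closedBall.2 ((ContinuousMap.dist_le hr.le).2 fun τ => ?_)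
    have hI := intervalIntegral.norm_integral_le_of_norm_le_const (a := (0 : ℝ)) (b := 1)
      (f := fun σ => A τ σ • f (t₀ + h * σ) (IccExtend zero_le_one Q σ)) (C := B * F)
      fun σ hσ => by
        rw [uIoc_of_le zero_le_one] at hσ
        have hσ' := Ioc_subset_Icc_self hσ
        rw [norm_smul]
        exact mul_le_mul (hB τ τ.2 σ hσ') (hF (_, _) ⟨ht σ hσ', hball Q hQ σ⟩) (norm_nonneg _) hB0
    rw [sub_zero, abs_one, mul_one] at hI
    rw [dist_eq_norm]
    simp only [hT, ContinuousMap.coe_mk, ContinuousMap.const_apply, add_assoc, add_sub_cancel_left]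
    have hBF : 0 ≤ B * F := (norm_nonneg _).trans hI
    calc _ ≤ ‖(h * (τ : ℝ)) • v₀‖ + ‖h ^ 2 • ∫ σ in (0 : ℝ)..1,
          A τ σ • f (t₀ + h * σ) (IccExtend zero_le_one Q σ)‖ := norm_add_le _ _
      _ ≤ |h| * ‖v₀‖ + |h| * (B * F) := by
          refine add_le_add ?_ ?_
          · rw [norm_smul, Real.norm_eq_abs, abs_mul, abs_of_nonneg τ.2.1]
            gcongr
            exact mul_le_of_le_one_right (abs_nonneg _) τ.2.2
          · rw [norm_smul, norm_pow, Real.norm_eq_abs]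
            refine mul_le_mul ?_ hI (norm_nonneg _) (abs_nonneg _)
            rw [pow_two]
            exact mul_le_of_le_one_right (abs_nonneg _) h1
      _ ≤ r := by rw [← mul_add]; exact hr'
  have hlip : ContractingWith (1 / 2 : NNReal) (hmaps.restrict T _ _) := by
    refine ⟨by norm_num, LipschitzWith.of_dist_le_mul fun Q Q' => ?_⟩
    rw [Subtype.dist_eq, Subtype.dist_eq]
    refine (ContinuousMap.dist_le (by positivity)).2 fun τ => ?_
    have := hcontr _ _ (fun σ _ => hball Q Q.2 σ) (fun σ _ => hball Q' Q'.2 σ)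
      (dist (Q : C(Icc (0 : ℝ) 1, Vec d)) Q')
      (fun σ _ => by rw [← dist_eq_norm]; exact ContinuousMap.dist_apply_le_dist _)
      τ τ.2 (hii Q τ) (hii Q' τ)
    rw [dist_eq_norm]
    simp only [MapsTo.val_restrict_apply, hT, ContinuousMap.coe_mk, add_sub_add_left_eq_sub]
    simpa using this
  obtain ⟨Q, hQ, hfix, -⟩ := ContractingWith.exists_fixedPoint'
    Metric.isClosed_closedBall.isComplete hmaps hlip (Metric.mem_closedBall_self hr.le) (edist_ne_top _ _)
  refine ⟨IccExtend zero_le_one Q, Q.continuous.Icc_extend', fun τ hτ => ⟨hball Q hQ τ, ?_⟩⟩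
  rw [IccExtend_of_mem _ _ hτ]
  exact (DFunLike.congr_fun hfix.symm ⟨τ, hτ⟩)

end Solvability

/-! ### Order of the method -/

section Order

variable {A : ℝ → ℝ → ℝ} {d : ℕ} {f : ℝ → Vec d → Vec d} {t₀ : ℝ} {q₀ v₀ : Vec d}
  {q v : ℝ → Vec d} {r : ℝ} {Q : ℝ → ℝ → Vec d}

/-- Continuous stages near `q₀`, compared with the exact solution, are in the situation of
`StageError`. -/
lemma stageError_of_stages (hA : Continuous (Function.uncurry A))
    (hf : ContDiff ℝ ∞ (Function.uncurry f)) (hq : IsLocalSolution f t₀ q₀ v₀ q v)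
    (hqc : Continuous q) (hr : 0 < r) (hQc : ∀ h, Continuous (Q h))
    (hQ : ∀ᶠ h in 𝓝 (0 : ℝ), ∀ τ ∈ Icc (0 : ℝ) 1,
      Q h τ ∈ Metric.closedBall q₀ r ∧ Q h τ = q₀ + (h * τ) • v₀
        + h ^ 2 • ∫ σ in (0 : ℝ)..1, A τ σ • f (t₀ + h * σ) (Q h σ)) :
    StageError A (fun s => f (t₀ + s) (q (t₀ + s)))
      (fun s => spaceDeriv f (t₀ + s) (q (t₀ + s)))
      (fun h τ => q (t₀ + h * τ) - Q h τ)
      (fun h τ => f (t₀ + h * τ) (q (t₀ + h * τ)) - f (t₀ + h * τ) (Q h τ)) := by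
  have hfc := hf.continuous
  have hDf := contDiff_spaceDeriv hf
  have hDc := hDf.continuous
  have hgc : Continuous fun s => f (t₀ + s) (q (t₀ + s)) :=
    hfc.comp (by fun_prop : Continuous fun s => (t₀ + s, q (t₀ + s)))
  have hΔc : ∀ h, Continuous fun τ => f (t₀ + h * τ) (q (t₀ + h * τ)) - f (t₀ + h * τ) (Q h τ) := by
    intro h
    have := hQc h
    exact (hfc.comp (by fun_prop : Continuous fun τ => (t₀ + h * τ, q (t₀ + h * τ)))).sub
      (hfc.comp (by fun_prop : Continuous fun τ => (t₀ + h * τ, Q h τ)))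
  have hcurve : ∀ n : ℕ, ContDiffAt ℝ n (fun s => (t₀ + s, q (t₀ + s))) 0 := by
    intro n
    have h1 : ContDiffAt ℝ n (fun s : ℝ => t₀ + s) 0 := contDiffAt_const.add contDiffAt_id
    refine h1.prodMk (ContDiffAt.comp 0 ?_ h1)
    rw [add_zero]
    exact hq.contDiffAt hf n
  have hqball : ∀ᶠ h in 𝓝 (0 : ℝ), ∀ τ ∈ Icc (0 : ℝ) 1,
      q (t₀ + h * τ) ∈ Metric.closedBall q₀ r := by
    refine eventually_forall_unit_of_eventually (P := fun t => q t ∈ Metric.closedBall q₀ r) ?_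
    have : Tendsto q (𝓝 t₀) (𝓝 q₀) := hq.init_position ▸ hqc.tendsto t₀
    exact this (Metric.closedBall_mem_nhds _ hr)
  have hstage : ∀ᶠ h in 𝓝 (0 : ℝ), ∀ τ ∈ Icc (0 : ℝ) 1, q (t₀ + h * τ) - Q h τ
      = h ^ 2 • stageResidual A (fun s => f (t₀ + s) (q (t₀ + s))) h τ
        + h ^ 2 • ∫ σ in (0 : ℝ)..1,
          A τ σ • (f (t₀ + h * σ) (q (t₀ + h * σ)) - f (t₀ + h * σ) (Q h σ)) := by
    filter_upwards [hQ, hq.position_eq hf hqc] with h h1 h2 τ hτ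
    have hAτ : Continuous fun σ => A τ σ :=
      hA.comp (by fun_prop : Continuous fun σ : ℝ => (τ, σ))
    have hEτ : Continuous fun σ => exactKernel τ σ :=
      continuous_exactKernel.comp (by fun_prop : Continuous fun σ : ℝ => (τ, σ))
    have hF : Continuous fun σ => f (t₀ + h * σ) (q (t₀ + h * σ)) := hgc.comp (by fun_prop)
    have hG : Continuous fun σ => f (t₀ + h * σ) (Q h σ) := by
      have := hQc h
      exact hfc.comp (by fun_prop : Continuous fun τ => (t₀ + h * τ, Q h τ))
    rw [h2 τ hτ, (h1 τ hτ).2, stageResidual, ← smul_add, add_sub_add_left_eq_sub, ← smul_sub,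
      ← intervalIntegral.integral_sub (Continuous.intervalIntegrable (by fun_prop) _ _)
        (Continuous.intervalIntegrable (by fun_prop) _ _)]
    have hDτ : Continuous fun σ => defect A τ σ := hEτ.sub hAτ
    rw [← intervalIntegral.integral_add (Continuous.intervalIntegrable (by fun_prop) _ _)
        (Continuous.intervalIntegrable (by fun_prop) _ _)]
    congr 1
    refine intervalIntegral_congr_unit fun σ _ => ?_
    simp only [defect]
    module
  refine ⟨hA, hgc, fun n => ?_, ?_, fun n => ?_, fun h => ?_, hΔc, ?_, ?_, hstage⟩
  · exact hasExpansion_of_contDiffAt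
      ((hf.of_le (by exact_mod_cast le_top)).contDiffAt.comp 0 (hcurve n))
  · exact hDc.comp (by fun_prop : Continuous fun s => (t₀ + s, q (t₀ + s)))
  · exact hasExpansion_of_contDiffAt
      ((hDf.of_le (by exact_mod_cast le_top)).contDiffAt.comp 0 (hcurve n))
  · have := hQc h
    fun_prop
  · obtain ⟨L, hL0, hL⟩ := exists_lipschitz_problem hf t₀ q₀ r
    have hΔ0 : IsUniformO
        (fun h τ => f (t₀ + h * τ) (q (t₀ + h * τ)) - f (t₀ + h * τ) (Q h τ)) 0 := by
      refine ⟨L * (2 * r), ?_⟩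
      filter_upwards [hQ, hqball, eventually_time_mem t₀] with h h1 h2 h3 τ hτ
      have e1 := mem_closedBall_iff_norm.1 (h2 τ hτ)
      have e2 := mem_closedBall_iff_norm.1 (h1 τ hτ).1
      rw [pow_zero, mul_one]
      refine (hL _ (h3 τ hτ) _ (h2 τ hτ) _ (h1 τ hτ).1).trans (mul_le_mul_of_nonneg_left ?_ hL0)
      calc ‖q (t₀ + h * τ) - Q h τ‖ = ‖(q (t₀ + h * τ) - q₀) - (Q h τ - q₀)‖ := by congr 1; abel
        _ ≤ ‖q (t₀ + h * τ) - q₀‖ + ‖Q h τ - q₀‖ := norm_sub_le _ _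
        _ ≤ 2 * r := by linarith
    have hres : IsUniformO (stageResidual A fun s => f (t₀ + s) (q (t₀ + s))) 0 :=
      (isUniformO_zero_of_continuous hgc).integral_kernel (continuous_defect hA)
    exact ((hres.pow_smul 2).add ((hΔ0.integral_kernel hA).pow_smul 2)).congr hstage
  · obtain ⟨C, hC⟩ := exists_linearization_problem hf t₀ q₀ r
    refine ⟨C, ?_⟩
    filter_upwards [hQ, hqball, eventually_time_mem t₀] with h h1 h2 h3 τ hτ
    exact hC _ (h3 τ hτ) _ (h2 τ hτ) _ (h1 τ hτ).1

/-- The order of the method is governed by the weighted integrals of the error of `f`. -/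
lemma hasOrderAtLeast_of_stageError (hA : Continuous (Function.uncurry A)) (m : ℕ)
    (H : ∀ (d : ℕ) (g : ℝ → Vec d) (J : ℝ → Vec d →L[ℝ] Vec d) (E Δ : ℝ → ℝ → Vec d),
      StageError A g J E Δ →
        IsUniformO (fun h _ => ∫ τ in (0 : ℝ)..1, (1 - τ) • Δ h τ) m ∧
        IsUniformO (fun h _ => ∫ τ in (0 : ℝ)..1, (1 : ℝ) • Δ h τ) (m + 1)) :
    (kernelMethod A).HasOrderAtLeast (m + 1) := by
  intro d f hf t₀ q₀ v₀ q v hq r hr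
  obtain ⟨q', hqc, hqq⟩ := hq.exists_continuous_extension
  have hq' := hq.congr hqq
  have hfc := hf.continuous
  have hex := eventually_stage_exists hA hf t₀ q₀ v₀ hr
  -- one continuous family of stages for every `h`; its values for `h` without a solution are
  -- irrelevant
  have hch : ∀ h : ℝ, ∃ Q : ℝ → Vec d, Continuous Q ∧
      ((∃ Q : ℝ → Vec d, Continuous Q ∧ ∀ τ ∈ Icc (0 : ℝ) 1,
        Q τ ∈ Metric.closedBall q₀ r ∧ Q τ = q₀ + (h * τ) • v₀
          + h ^ 2 • ∫ σ in (0 : ℝ)..1, A τ σ • f (t₀ + h * σ) (Q σ)) →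
        ∀ τ ∈ Icc (0 : ℝ) 1, Q τ ∈ Metric.closedBall q₀ r ∧ Q τ = q₀ + (h * τ) • v₀
          + h ^ 2 • ∫ σ in (0 : ℝ)..1, A τ σ • f (t₀ + h * σ) (Q σ)) := by
    intro h
    by_cases hh : ∃ Q : ℝ → Vec d, Continuous Q ∧ ∀ τ ∈ Icc (0 : ℝ) 1,
        Q τ ∈ Metric.closedBall q₀ r ∧ Q τ = q₀ + (h * τ) • v₀
          + h ^ 2 • ∫ σ in (0 : ℝ)..1, A τ σ • f (t₀ + h * σ) (Q σ)
    · obtain ⟨Q, hQ⟩ := hh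
      exact ⟨Q, hQ.1, fun _ => hQ.2⟩
    · exact ⟨fun _ => 0, continuous_const, fun h' => absurd h' hh⟩
  choose Q hQc hQ' using hch
  have hQ := hex.mono fun h hh => hQ' h hh
  have hS := stageError_of_stages hA hf hq' hqc hr hQc hQ
  obtain ⟨⟨C₁, hC₁⟩, ⟨C₂, hC₂⟩⟩ := H d _ _ _ _ hS
  have hev : ∀ᶠ h in 𝓝 (0 : ℝ), ∃ z₁ : Vec d × Vec d,
        (kernelMethod A).method f (Metric.closedBall q₀ r) h t₀ (q₀, v₀) z₁ ∧
        (∀ z, (kernelMethod A).method f (Metric.closedBall q₀ r) h t₀ (q₀, v₀) z → z = z₁) ∧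
        ‖q (t₀ + h) - z₁.1‖ ≤ max C₁ C₂ * |h| ^ (m + 1 + 1) ∧
        ‖v (t₀ + h) - z₁.2‖ ≤ max C₁ C₂ * |h| ^ (m + 1 + 1) := by
    filter_upwards [hQ, hC₁, hC₂, eventually_stage_unique hA hf t₀ q₀ v₀ r,
      hq'.position_eq hf hqc, hq'.velocity_eq hf hqc,
      eventually_forall_unit_of_eventually hqq] with h hQh hC₁h hC₂h huniq hpos hvel hqqh
    have h1mem : (1 : ℝ) ∈ Icc (0 : ℝ) 1 := right_mem_Icc.2 zero_le_one
    have hF : Continuous fun σ => f (t₀ + h * σ) (q' (t₀ + h * σ)) :=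
      hfc.comp (by fun_prop : Continuous fun τ => (t₀ + h * τ, q' (t₀ + h * τ)))
    have hG : Continuous fun σ => f (t₀ + h * σ) (Q h σ) := by
      have := hQc h
      exact hfc.comp (by fun_prop : Continuous fun τ => (t₀ + h * τ, Q h τ))
    have hAτ : ∀ τ, Continuous fun σ => A τ σ := fun τ =>
      hA.comp (by fun_prop : Continuous fun σ : ℝ => (τ, σ))
    have ht : ∀ σ, t₀ + σ * h = t₀ + h * σ := fun σ => by rw [mul_comm]
    have hmethod : (kernelMethod A).method f (Metric.closedBall q₀ r) h t₀ (q₀, v₀)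
        (q₀ + h • v₀ + h ^ 2 • ∫ τ in (0 : ℝ)..1, (1 - τ) • f (t₀ + h * τ) (Q h τ),
          v₀ + h • ∫ τ in (0 : ℝ)..1, f (t₀ + h * τ) (Q h τ)) := by
      refine ⟨Q h, fun τ hτ => (hQh τ hτ).1, ⟨fun τ _ => ?_, ?_, ?_, fun τ hτ => ?_, ?_, ?_⟩⟩
      · have := hAτ τ
        simp only [kernelMethod, ht]
        exact Continuous.intervalIntegrable (by fun_prop) _ _
      · simp only [kernelMethod, ht]
        exact Continuous.intervalIntegrable (by fun_prop) _ _
      · simp only [kernelMethod, ht]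
        exact Continuous.intervalIntegrable (by fun_prop) _ _
      · simp only [kernelMethod, ht]
        exact (hQh τ hτ).2
      · simp only [kernelMethod, ht]
      · simp only [kernelMethod, ht, one_smul]
    refine ⟨_, hmethod, fun z hz => huniq z _ hz hmethod, ?_, ?_⟩
    · have hp := hpos 1 h1mem
      have hk : ∫ σ in (0 : ℝ)..1, exactKernel 1 σ • f (t₀ + h * σ) (q' (t₀ + h * σ))
          = ∫ σ in (0 : ℝ)..1, (1 - σ) • f (t₀ + h * σ) (q' (t₀ + h * σ)) :=
        intervalIntegral_congr_unit fun σ hσ => by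
          rw [exactKernel, max_eq_left (by linarith [hσ.2])]
      have hqe := hqqh 1 h1mem
      rw [mul_one] at hp hqe
      have he : q (t₀ + h) - (q₀ + h • v₀
          + h ^ 2 • ∫ τ in (0 : ℝ)..1, (1 - τ) • f (t₀ + h * τ) (Q h τ))
          = h ^ 2 • ∫ τ in (0 : ℝ)..1,
            (1 - τ) • (f (t₀ + h * τ) (q' (t₀ + h * τ)) - f (t₀ + h * τ) (Q h τ)) := by
        rw [← hqe, hp, hk, add_sub_add_left_eq_sub, ← smul_sub, ← intervalIntegral.integral_sub
          (Continuous.intervalIntegrable (by fun_prop) _ _)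
          (Continuous.intervalIntegrable (by fun_prop) _ _)]
        simp only [smul_sub]
      simp only
      rw [he, norm_smul, norm_pow, Real.norm_eq_abs]
      calc _ ≤ |h| ^ 2 * (C₁ * |h| ^ m) := by gcongr; exact hC₁h 1 h1mem
        _ = C₁ * |h| ^ (m + 1 + 1) := by ring
        _ ≤ _ := by gcongr; exact le_max_left _ _
    · have he : v (t₀ + h) - (v₀ + h • ∫ τ in (0 : ℝ)..1, f (t₀ + h * τ) (Q h τ))
          = h • ∫ τ in (0 : ℝ)..1,
            (1 : ℝ) • (f (t₀ + h * τ) (q' (t₀ + h * τ)) - f (t₀ + h * τ) (Q h τ)) := by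
        rw [hvel, add_sub_add_left_eq_sub, ← smul_sub, ← intervalIntegral.integral_sub
          (Continuous.intervalIntegrable (by fun_prop) _ _)
          (Continuous.intervalIntegrable (by fun_prop) _ _)]
        simp only [one_smul]
      simp only
      rw [he, norm_smul, Real.norm_eq_abs]
      calc _ ≤ |h| * (C₂ * |h| ^ (m + 1)) := by gcongr; exact hC₂h 1 h1mem
        _ = C₂ * |h| ^ (m + 1 + 1) := by ring
        _ ≤ _ := by gcongr; exact le_max_right _ _
  obtain ⟨ε, hε, hball⟩ := Metric.eventually_nhds_iff_ball.1 hev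
  refine ⟨max C₁ C₂, ε / 2, half_pos hε, fun h hh => hball h ?_⟩
  rw [mem_ball_zero_iff, Real.norm_eq_abs]
  linarith

lemma hasOrderAtLeast_two_kernelMethod (hA : Continuous (Function.uncurry A)) :
    (kernelMethod A).HasOrderAtLeast 2 :=
  hasOrderAtLeast_of_stageError hA 1 fun _ _ _ _ _ S =>
    ⟨((S.isUniformO_Δ S.isUniformO_E).integral (by fun_prop)).mono one_le_two,
      (S.isUniformO_Δ S.isUniformO_E).integral continuous_const⟩

/-- The weight `1 - τ` costs one degree of vanishing moments. -/
lemma DefectMomentsVanish.one_sub_weight (hA : Continuous (Function.uncurry A)) {n : ℕ}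
    (hm : DefectMomentsVanish A (n + 1)) (a b : ℕ) (hab : a + b < n) :
    ∫ τ in (0 : ℝ)..1, (1 - τ) * defectMoment A b τ * τ ^ a = 0 := by
  have hc := continuous_defectMoment hA b
  have h1 : ∀ τ : ℝ, (1 - τ) * defectMoment A b τ * τ ^ a
      = τ ^ a * defectMoment A b τ - τ ^ (a + 1) * defectMoment A b τ := fun τ => by ring
  simp only [h1]
  rw [intervalIntegral.integral_sub (Continuous.intervalIntegrable (by fun_prop) _ _)
    (Continuous.intervalIntegrable (by fun_prop) _ _), hm a b (by omega), hm (a + 1) b (by omega),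
    sub_zero]

lemma hasOrderAtLeast_four_kernelMethod (hA : Continuous (Function.uncurry A))
    (hm : DefectMomentsVanish A 2) : (kernelMethod A).HasOrderAtLeast 4 :=
  hasOrderAtLeast_of_stageError hA 3 fun _ _ _ _ _ S =>
    ⟨S.isUniformO_integral_Δ (n := 1) S.isUniformO_E (by fun_prop) (hm.one_sub_weight hA)
        (by norm_num) (by norm_num) (by norm_num),
      S.isUniformO_integral_Δ (n := 2) (u := fun _ => 1) S.isUniformO_E continuous_const
        (fun a b hab => by simpa only [one_mul, mul_comm (_ ^ a)] using hm a b hab)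
        (by norm_num) (by norm_num) (by norm_num)⟩

lemma hasOrderAtLeast_six_kernelMethod (hA : Continuous (Function.uncurry A))
    (hs : IsSymmetricKernel A) (h0 : ∀ τ ∈ Icc (0 : ℝ) 1, defectMoment A 0 τ = 0)
    (hm : DefectMomentsVanish A 4) : (kernelMethod A).HasOrderAtLeast 6 :=
  hasOrderAtLeast_of_stageError hA 5 fun _ _ _ _ _ S =>
    ⟨S.isUniformO_integral_Δ (n := 3) (S.isUniformO_E_three h0) (by fun_prop)
        (hm.one_sub_weight hA) (by norm_num) (by norm_num) (by norm_num),
      S.isUniformO_integral_Δ_six hs h0 hm⟩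

end Order

theorem mainTheorem3 (M : CSRKN) (α : ℕ → ℕ → ℝ)
    (hA : HasSymmetricLegendreForm M.A α)
    (hBbar : ∀ τ ∈ Set.Icc (0 : ℝ) 1, M.Bbar τ = M.B τ * (1 - M.C τ))
    (hB : ∀ τ ∈ Set.Icc (0 : ℝ) 1, M.B τ = 1)
    (hC : ∀ τ ∈ Set.Icc (0 : ℝ) 1, M.C τ = τ) :
    M.IsSymmetric ∧
    M.HasOrderAtLeast 2 ∧
    (α 0 0 = 1 / 6 → M.HasOrderAtLeast 4) ∧
    (α 0 0 = 1 / 6 → α 1 1 = -1 / 10 →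
      α 2 0 = Real.sqrt 5 / 60 → α 0 2 = Real.sqrt 5 / 60 →
      (∀ i : ℕ, Even i → 2 < i → α i 0 = 0) → M.HasOrderAtLeast 6) := by
  have hmethod : ∀ (d : ℕ) (f : ℝ → Vec d → Vec d) (U : Set (Vec d)),
      M.method f U = (kernelMethod (legendreKernel α)).method f U := fun d f U =>
    CSRKN.method_congr (fun τ hτ σ hσ => hA.eq_legendreKernel hτ hσ)
      (fun τ hτ => by rw [hBbar τ hτ, hB τ hτ, hC τ hτ, one_mul, kernelMethod])
      (fun τ hτ => by rw [hB τ hτ, kernelMethod]) (fun τ hτ => by rw [hC τ hτ, kernelMethod]) f U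
  have hsum := hA.summable
  have hcont := continuous_legendreKernel hsum
  simp only [CSRKN.IsSymmetric, CSRKN.HasOrderAtLeast, hmethod]
  exact ⟨isSymmetric_kernelMethod isSymmetricKernel_legendreKernel,
    hasOrderAtLeast_two_kernelMethod hcont,
    fun h00 => hasOrderAtLeast_four_kernelMethod hcont
      (defectMomentsVanish_two_legendreKernel hsum h00),
    fun h00 h11 h20 h02 hi0 => hasOrderAtLeast_six_kernelMethod hcont
      isSymmetricKernel_legendreKernel
      (fun τ hτ => defectMoment_zero_legendreKernel hsum h00 h20 hi0 hτ)
      (defectMomentsVanish_four_legendreKernel hsum h00 h11 h20 h02 hi0)⟩
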